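/- Let $n\ge 1$, $0<\alpha\le 1$ and $\lambda>(3n+2\alpha)/n$. Let $\mathcal C_\alpha$ be the set of all functions $\varphi$ on $\mathbb R^n$ with support in $\{|x|\le 1\}$, $\int_{\mathbb R^n}\varphi(x)\,dx=0$ and $|\varphi(x)-\varphi(x')|\le|x-x'|^\alpha$ for all $x,x'\in\mathbb R^n$. For $t>0$ put $\varphi_t(x)=t^{-n}\varphi(x/t)$. For $f\in L^1(\mathbb R^n)$, $y\in\mathbb R^n$ and $t>0$ let $$A_\alpha(f)(y,t)=\sup_{\varphi\in\mathcal C_\alpha}\left|\int_{\mathbb R^n}\varphi_t(y-z)f(z)\,dz\right|,$$ and for $x\in\mathbb R^n$ let $$g^*_{\lambda,\alpha}(f)(x)=\left(\int_0^\infty\!\!\int_{\mathbb R^n}\left(\frac{t}{t+|x-y|}\right)^{\lambda n}A_\alpha(f)(y,t)^2\,\frac{dy\,dt}{t^{n+1}}\right)^{1/2}\in[0,\infty].$$ (Here $f$ and the kernels $\varphi$ are either all real-valued or all complex-valued.) Then there is a constant $C>0$, independent of $f$ and $\sigma$, such that for every $f\in L^1(\mathbb R^n)$ and every $\sigma>0$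 $$\left|\left\{x\in\mathbb R^n: g^*_{\lambda,\alpha}(f)(x)>\sigma\right\}\right|\le\frac{C}{\sigma}\int_{\mathbb R^n}|f(x)|\,dx.$$ -/

import Mathlib

open MeasureTheory
open scoped ENNReal

noncomputable section

namespace IntrinsicSquare

/-- The family of test kernels on Euclidean space: functions with (closed) support in the closed
unit ball, mean zero, and Hölder continuous of order `α` with constant `1`. -/
def kernelClass (𝕜 : Type*) [RCLike 𝕜] (n : ℕ) (α : ℝ) : Set (EuclideanSpace ℝ (Fin n) → 𝕜) :=
  {φ | tsupport φ ⊆ Metric.closedBall 0 1 ∧ ∫ x, φ x = 0 ∧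
    ∀ x x', ‖φ x - φ x'‖ ≤ ‖x - x'‖ ^ α}

/-- The `L¹`-dilation `φ_t(x) = t⁻ⁿ φ(x / t)`. -/
def dilation {𝕜 : Type*} [RCLike 𝕜] {n : ℕ} (φ : EuclideanSpace ℝ (Fin n) → 𝕜) (t : ℝ)
    (x : EuclideanSpace ℝ (Fin n)) : 𝕜 :=
  ((t ^ n)⁻¹ : ℝ) • φ (t⁻¹ • x)

/-- `A_α(f)(y,t) = sup_φ |f * φ_t (y)|`, the supremum over the kernel class taken in `[0, ∞]`. -/
def maximalConv {𝕜 : Type*} [RCLike 𝕜] {n : ℕ} (α : ℝ) (f : EuclideanSpace ℝ (Fin n) → 𝕜)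
    (y : EuclideanSpace ℝ (Fin n)) (t : ℝ) : ℝ≥0∞ :=
  ⨆ φ ∈ kernelClass 𝕜 n α, ‖∫ z, dilation φ t (y - z) * f z‖ₑ

/-- The intrinsic `g*`-function, with values in `[0, ∞]`; the integral is over the upper half-space
`{(y, t) : t > 0}`. -/
def gStar {𝕜 : Type*} [RCLike 𝕜] {n : ℕ} (lam α : ℝ) (f : EuclideanSpace ℝ (Fin n) → 𝕜)
    (x : EuclideanSpace ℝ (Fin n)) : ℝ≥0∞ :=
  (∫⁻ p in {p : EuclideanSpace ℝ (Fin n) × ℝ | 0 < p.2},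
      ENNReal.ofReal ((p.2 / (p.2 + ‖x - p.1‖)) ^ (lam * n)) * maximalConv α f p.1 p.2 ^ 2
        * ENNReal.ofReal (1 / p.2 ^ (n + 1))) ^ (1 / 2 : ℝ)

end IntrinsicSquare

end

/-! The proof is Calderón–Zygmund theory for a square function whose kernel is a supremum over a
whole class. Split `f = g + ∑ b i` at height `σ`, with `g` bounded by `5 ^ n * σ` and each `b i` of
mean zero and supported in a ball.

For `g` an `L²` bound suffices. Integrating the weight in `x` gives a multiple of `t ^ n`, so the
aperture disappears and the bound reduces to `∫∫ A(g)² dy dt / t ≤ C ‖g‖₂²`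
(`lintegral_maximalConv_sq_le`). The supremum is linearized by a measurable choice of a
near-extremal kernel at each `(y, t)`, and `TT*` is applied to the resulting linear operator. A Gram
entry at `(y, t)`, `(x, s)` is at most a constant times `min(t/s, s/t) ^ α * max(t, s) ^ (-n)` and
vanishes for `|y - x| > t + s`: the kernel of smaller scale has mean zero and the other one is
Hölder. This holds whichever kernels were chosen, so Schur's test gives a bound independent of the
choice.

For a bad part `b` in the ball `B(c, R)` and `x` with `r = |x - c| > 2R`, cancellation gives
`A(b)(y, t) ≤ t ^ (-n) * min(3, (R/t) ^ α) * ‖b‖₁`, and this vanishes unless `|y - c| ≤ R + t`.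
There the base of the weight is at most `min(1, 2t/r)`. As `λn ≥ 3n + α`, the integral over `t`
converges, and `g*(b)(x) ≤ C ‖b‖₁ R ^ (-n) * (R/r) ^ (n + α/2)` (`gStar_le_of_support`). This is
integrable away from the ball, with integral at most `C ‖b‖₁`. The union of the doubled balls has
measure at most `C ‖f‖₁ / σ`, and Chebyshev's inequality concludes. -/

noncomputable section

namespace IntrinsicSquare

/-! ### Test kernels, their dilations, and measurability of the maximal convolution -/

section Kernels

variable {𝕜 : Type*} [RCLike 𝕜] {n : ℕ} {α : ℝ} {φ : EuclideanSpace ℝ (Fin n) → 𝕜}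

lemma zero_mem_kernelClass : (0 : EuclideanSpace ℝ (Fin n) → 𝕜) ∈ kernelClass 𝕜 n α := by
  refine ⟨by simp [tsupport], by simp, fun x x' => ?_⟩
  simpa using Real.rpow_nonneg (norm_nonneg _) α

lemma continuous_of_mem_kernelClass (hα : 0 < α) (hφ : φ ∈ kernelClass 𝕜 n α) : Continuous φ := by
  rw [continuous_iff_continuousAt]
  intro x
  rw [ContinuousAt, tendsto_iff_norm_sub_tendsto_zero]
  have h : Filter.Tendsto (fun y => ‖y - x‖ ^ α) (nhds x) (nhds 0) := by
    have : Continuous fun y : EuclideanSpace ℝ (Fin n) => ‖y - x‖ ^ α :=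
      (continuous_id.sub continuous_const).norm.rpow_const fun _ => Or.inr hα.le
    simpa [Real.zero_rpow hα.ne'] using this.tendsto x
  exact squeeze_zero (fun _ => norm_nonneg _) (fun y => hφ.2.2 y x) h

lemma eq_zero_of_mem_kernelClass (hφ : φ ∈ kernelClass 𝕜 n α) {x : EuclideanSpace ℝ (Fin n)}
    (hx : 1 < ‖x‖) : φ x = 0 := by
  by_contra h
  have := hφ.1 (subset_tsupport φ h)
  rw [mem_closedBall_zero_iff] at this
  linarith

/-- Since `n ≥ 1` there is a point of norm 2, where `φ` vanishes. It lies within distance 3 of every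
point of the unit ball, and `3 ^ α ≤ 3`. -/
lemma norm_le_of_mem_kernelClass (hn : 1 ≤ n) (hα : 0 < α) (hα' : α ≤ 1)
    (hφ : φ ∈ kernelClass 𝕜 n α) (x : EuclideanSpace ℝ (Fin n)) : ‖φ x‖ ≤ 3 := by
  rcases lt_or_ge 1 ‖x‖ with hx | hx
  · simp [eq_zero_of_mem_kernelClass hφ hx]
  have : Nonempty (Fin n) := ⟨⟨0, hn⟩⟩
  obtain ⟨v, hv⟩ := NormedSpace.exists_lt_norm ℝ (EuclideanSpace ℝ (Fin n)) 0
  have hw : ‖(2 * ‖v‖⁻¹) • v‖ = 2 := by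
    rw [norm_smul, norm_mul, norm_inv, norm_norm]
    simp [hv.ne']
  have h := hφ.2.2 x ((2 * ‖v‖⁻¹) • v)
  rw [eq_zero_of_mem_kernelClass hφ (x := (2 * ‖v‖⁻¹) • v) (by rw [hw]; norm_num), sub_zero] at h
  have h3 : ‖x - (2 * ‖v‖⁻¹) • v‖ ≤ 3 := by
    refine (norm_sub_le _ _).trans ?_
    rw [hw]; linarith
  refine h.trans ((Real.rpow_le_rpow (norm_nonneg _) h3 hα.le).trans ?_)
  simpa using Real.rpow_le_rpow_of_exponent_le (by norm_num : (1 : ℝ) ≤ 3) hα'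

lemma continuous_dilation (hφ : Continuous φ) (t : ℝ) : Continuous (dilation φ t) := by
  unfold dilation
  fun_prop

lemma measurable_dilation (hφ : Continuous φ) :
    Measurable fun q : ℝ × EuclideanSpace ℝ (Fin n) => dilation φ q.1 q.2 := by
  unfold dilation
  have : Measurable φ := hφ.measurable
  fun_prop

lemma norm_dilation_le (hn : 1 ≤ n) (hα : 0 < α) (hα' : α ≤ 1) (hφ : φ ∈ kernelClass 𝕜 n α)
    (t : ℝ) (x : EuclideanSpace ℝ (Fin n)) : ‖dilation φ t x‖ ≤ (|t| ^ n)⁻¹ * 3 := by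
  rw [dilation, norm_smul]
  simp only [Real.norm_eq_abs, abs_inv, abs_pow]
  gcongr
  exact norm_le_of_mem_kernelClass hn hα hα' hφ _

lemma dilation_eq_zero (hφ : φ ∈ kernelClass 𝕜 n α) {t : ℝ} (ht : 0 < t)
    {x : EuclideanSpace ℝ (Fin n)} (hx : t < ‖x‖) : dilation φ t x = 0 := by
  rw [dilation, eq_zero_of_mem_kernelClass hφ, smul_zero]
  rw [norm_smul, norm_inv, Real.norm_of_nonneg ht.le, inv_mul_eq_div, one_lt_div ht]
  exact hx

lemma norm_dilation_sub_le (hφ : φ ∈ kernelClass 𝕜 n α) {t : ℝ} (ht : 0 < t)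
    (x x' : EuclideanSpace ℝ (Fin n)) :
    ‖dilation φ t x - dilation φ t x'‖ ≤ (t ^ n)⁻¹ * (‖x - x'‖ / t) ^ α := by
  rw [dilation, dilation, ← smul_sub, norm_smul, norm_inv, norm_pow, Real.norm_of_nonneg ht.le]
  gcongr
  refine (hφ.2.2 _ _).trans (le_of_eq ?_)
  rw [← smul_sub, norm_smul, norm_inv, Real.norm_of_nonneg ht.le, inv_mul_eq_div]

lemma integral_dilation_sub (hφ : φ ∈ kernelClass 𝕜 n α) (t : ℝ)
    (y : EuclideanSpace ℝ (Fin n)) : ∫ z, dilation φ t (y - z) = 0 := by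
  rw [integral_sub_left_eq_self (dilation φ t) volume y]
  unfold dilation
  rw [integral_smul, Measure.integral_comp_smul, hφ.2.1, smul_zero, smul_zero]

lemma integrable_dilation_sub_mul (hn : 1 ≤ n) (hα : 0 < α) (hα' : α ≤ 1)
    (hφ : φ ∈ kernelClass 𝕜 n α) {h : EuclideanSpace ℝ (Fin n) → 𝕜} (hh : Integrable h)
    (t : ℝ) (y : EuclideanSpace ℝ (Fin n)) : Integrable fun z => dilation φ t (y - z) * h z := by
  refine hh.bdd_mul ((continuous_dilation (continuous_of_mem_kernelClass hα hφ) t).comp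
    (continuous_const.sub continuous_id)).aestronglyMeasurable (c := (|t| ^ n)⁻¹ * 3) ?_
  exact Filter.Eventually.of_forall fun z => norm_dilation_le hn hα hα' hφ t _

lemma norm_integral_dilation_mul_le (hn : 1 ≤ n) (hα : 0 < α) (hα' : α ≤ 1)
    (hφ : φ ∈ kernelClass 𝕜 n α) {h : EuclideanSpace ℝ (Fin n) → 𝕜} (hh : Integrable h)
    (t : ℝ) (y : EuclideanSpace ℝ (Fin n)) :
    ‖∫ z, dilation φ t (y - z) * h z‖ ≤ (|t| ^ n)⁻¹ * 3 * ∫ z, ‖h z‖ := by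
  rw [← integral_const_mul]
  refine norm_integral_le_of_norm_le (hh.norm.const_mul _)
    (Filter.Eventually.of_forall fun z => ?_)
  rw [norm_mul]
  gcongr
  exact norm_dilation_le hn hα hα' hφ t _

/-- The bound with 3 is the size estimate. The other uses the mean zero of `h`: the constant `φ_t(y
- c)` may be subtracted from the kernel, and the Hölder condition applies on the support of `h`. -/
lemma norm_integral_dilation_mul_le_min (hn : 1 ≤ n) (hα : 0 < α) (hα' : α ≤ 1)
    (hφ : φ ∈ kernelClass 𝕜 n α) {h : EuclideanSpace ℝ (Fin n) → 𝕜} (hh : Integrable h)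
    {c : EuclideanSpace ℝ (Fin n)} {R : ℝ} (hsupp : ∀ z, R < ‖z - c‖ → h z = 0)
    (h0 : ∫ z, h z = 0) {t : ℝ} (ht : 0 < t) (y : EuclideanSpace ℝ (Fin n)) :
    ‖∫ z, dilation φ t (y - z) * h z‖ ≤ (t ^ n)⁻¹ * min 3 ((R / t) ^ α) * ∫ z, ‖h z‖ := by
  rw [mul_min_of_nonneg _ _ (by positivity), min_mul_of_nonneg _ _ (by positivity)]
  refine le_min ?_ ?_
  · simpa [abs_of_pos ht] using norm_integral_dilation_mul_le hn hα hα' hφ hh t y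
  · have : ∫ z, dilation φ t (y - z) * h z
        = ∫ z, (dilation φ t (y - z) - dilation φ t (y - c)) * h z := by
      simp_rw [sub_mul]
      rw [integral_sub (integrable_dilation_sub_mul hn hα hα' hφ hh t y) (hh.const_mul _),
        integral_const_mul, h0, mul_zero, sub_zero]
    rw [this, ← integral_const_mul]
    refine norm_integral_le_of_norm_le (hh.norm.const_mul _)
      (Filter.Eventually.of_forall fun z => ?_)
    rw [norm_mul]
    rcases lt_or_ge R ‖z - c‖ with hz | hz
    · simp [hsupp z hz]
    gcongr
    refine (norm_dilation_sub_le hφ ht _ _).trans ?_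
    have : ‖y - z - (y - c)‖ = ‖z - c‖ := by
      rw [← norm_neg]; congr 1; abel
    rw [this]
    gcongr

lemma integral_dilation_mul_eq_zero (hφ : φ ∈ kernelClass 𝕜 n α)
    {h : EuclideanSpace ℝ (Fin n) → 𝕜}
    {c : EuclideanSpace ℝ (Fin n)} {R : ℝ} (hsupp : ∀ z, R < ‖z - c‖ → h z = 0)
    {t : ℝ} (ht : 0 < t) {y : EuclideanSpace ℝ (Fin n)} (hy : R + t < ‖y - c‖) :
    ∫ z, dilation φ t (y - z) * h z = 0 := by
  refine integral_eq_zero_of_ae (Filter.Eventually.of_forall fun z => ?_)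
  rcases lt_or_ge R ‖z - c‖ with hz | hz
  · simp [hsupp z hz]
  · have : t < ‖y - z‖ := by
      have := norm_add_le (y - z) (z - c)
      rw [sub_add_sub_cancel] at this
      linarith
    simp [dilation_eq_zero hφ ht this]

lemma maximalConv_lt_top (hn : 1 ≤ n) (hα : 0 < α) (hα' : α ≤ 1)
    {h : EuclideanSpace ℝ (Fin n) → 𝕜} (hh : Integrable h)
    (t : ℝ) (y : EuclideanSpace ℝ (Fin n)) : maximalConv α h y t < ∞ := by
  refine lt_of_le_of_lt (iSup₂_le fun φ hφ => ?_)
    (ENNReal.ofReal_lt_top (r := (|t| ^ n)⁻¹ * 3 * ∫ z, ‖h z‖))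
  rw [← ofReal_norm]
  exact ENNReal.ofReal_le_ofReal (norm_integral_dilation_mul_le hn hα hα' hφ hh t y)

lemma maximalConv_le_of_support (hn : 1 ≤ n) (hα : 0 < α) (hα' : α ≤ 1)
    {h : EuclideanSpace ℝ (Fin n) → 𝕜} (hh : Integrable h)
    {c : EuclideanSpace ℝ (Fin n)} {R : ℝ} (hsupp : ∀ z, R < ‖z - c‖ → h z = 0)
    (h0 : ∫ z, h z = 0) {t : ℝ} (ht : 0 < t) (y : EuclideanSpace ℝ (Fin n)) :
    maximalConv α h y t ≤ (Metric.closedBall c (R + t)).indicator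
      (fun _ => ENNReal.ofReal ((t ^ n)⁻¹ * min 3 ((R / t) ^ α) * ∫ z, ‖h z‖)) y := by
  refine iSup₂_le fun φ hφ => ?_
  by_cases hy : y ∈ Metric.closedBall c (R + t)
  · rw [Set.indicator_of_mem hy, ← ofReal_norm]
    exact ENNReal.ofReal_le_ofReal
      (norm_integral_dilation_mul_le_min hn hα hα' hφ hh hsupp h0 ht y)
  · rw [Metric.mem_closedBall, dist_eq_norm, not_le] at hy
    simp [integral_dilation_mul_eq_zero hφ hsupp ht hy]

/-- The kernel class is separable: countably many kernels compute `maximalConv`. -/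
lemma exists_seq_maximalConv_eq_iSup (𝕜 : Type*) [RCLike 𝕜] (hn : 1 ≤ n) (hα : 0 < α)
    (hα' : α ≤ 1) :
    ∃ φ : ℕ → EuclideanSpace ℝ (Fin n) → 𝕜, (∀ i, φ i ∈ kernelClass 𝕜 n α) ∧
      ∀ f : EuclideanSpace ℝ (Fin n) → 𝕜, Integrable f → ∀ y t,
        maximalConv α f y t = ⨆ i, ‖∫ z, dilation (φ i) t (y - z) * f z‖ₑ := by
  -- In the compact-open topology the continuous functions are second countable, so the class has a
  -- dense sequence. By dominated convergence the pairing with `f` is continuous in the kernel,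
  -- hence a bound on the dense sequence extends to the class.
  let S : Set C(EuclideanSpace ℝ (Fin n), 𝕜) := {F | ⇑F ∈ kernelClass 𝕜 n α}
  have : Nonempty S := ⟨⟨0, zero_mem_kernelClass⟩⟩
  let u := TopologicalSpace.denseSeq S
  refine ⟨fun i => (u i).1, fun i => (u i).2, fun f hf y t => le_antisymm ?_ ?_⟩
  · refine iSup₂_le fun φ hφ => ?_
    have hcont : Continuous fun F : S => ∫ z, dilation (F : C(_, 𝕜)) t (y - z) * f z := by
      refine continuous_of_dominated (bound := fun z => (|t| ^ n)⁻¹ * 3 * ‖f z‖) ?_ ?_ ?_ ?_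
      · exact fun F => (integrable_dilation_sub_mul hn hα hα' F.2 hf t y).aestronglyMeasurable
      · refine fun F => Filter.Eventually.of_forall fun z => ?_
        rw [norm_mul]
        gcongr
        exact norm_dilation_le hn hα hα' F.2 t _
      · exact hf.norm.const_mul _
      · refine Filter.Eventually.of_forall fun z => ?_
        unfold dilation
        have : Continuous fun F : S => (F : C(_, 𝕜)) (t⁻¹ • (y - z)) :=
          (continuous_eval_const _).comp continuous_subtype_val
        fun_prop
    have key : ∀ F : S, ‖∫ z, dilation (F : C(_, 𝕜)) t (y - z) * f z‖ₑ ≤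
        ⨆ i, ‖∫ z, dilation (u i : C(_, 𝕜)) t (y - z) * f z‖ₑ :=
      isClosed_property (TopologicalSpace.denseRange_denseSeq S)
        (isClosed_le hcont.enorm continuous_const)
        fun i => le_iSup (fun i => ‖∫ z, dilation (u i : C(_, 𝕜)) t (y - z) * f z‖ₑ) i
    exact key ⟨⟨φ, continuous_of_mem_kernelClass hα hφ⟩, hφ⟩
  · exact iSup_le fun i => le_iSup₂_of_le (u i).1 (u i).2 le_rfl

lemma measurable_integral_dilation_mul (hφ : Continuous φ) {f : EuclideanSpace ℝ (Fin n) → 𝕜}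
    (hf : StronglyMeasurable f) :
    Measurable fun p : EuclideanSpace ℝ (Fin n) × ℝ => ∫ z, dilation φ p.2 (p.1 - z) * f z := by
  refine (StronglyMeasurable.integral_prod_right (ν := volume)
    (f := fun (p : EuclideanSpace ℝ (Fin n) × ℝ) z => dilation φ p.2 (p.1 - z) * f z)
    (Measurable.stronglyMeasurable ?_)).measurable
  have h1 : Measurable fun q : (EuclideanSpace ℝ (Fin n) × ℝ) × EuclideanSpace ℝ (Fin n) =>
      dilation φ q.1.2 (q.1.1 - q.2) :=
    (measurable_dilation hφ).comp (by fun_prop :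
      Measurable fun q : (EuclideanSpace ℝ (Fin n) × ℝ) × EuclideanSpace ℝ (Fin n) =>
        (q.1.2, q.1.1 - q.2))
  exact h1.mul (hf.measurable.comp measurable_snd)

lemma measurable_maximalConv (hn : 1 ≤ n) (hα : 0 < α) (hα' : α ≤ 1)
    {f : EuclideanSpace ℝ (Fin n) → 𝕜} (hf : StronglyMeasurable f) (hfi : Integrable f) :
    Measurable fun p : EuclideanSpace ℝ (Fin n) × ℝ => maximalConv α f p.1 p.2 := by
  obtain ⟨φ, hφ, h⟩ := exists_seq_maximalConv_eq_iSup (n := n) 𝕜 hn hα hα'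
  simp_rw [h f hfi]
  exact Measurable.iSup fun i =>
    (measurable_integral_dilation_mul (continuous_of_mem_kernelClass hα (hφ i)) hf).enorm

lemma maximalConv_congr_ae {f g : EuclideanSpace ℝ (Fin n) → 𝕜} (h : f =ᵐ[volume] g) :
    maximalConv α f = maximalConv α g := by
  ext y t
  unfold maximalConv
  congr! 4 with φ hφ
  exact integral_congr_ae (h.mono fun z hz => by simp [hz])

end Kernels

/-! ### Decay integrals in space and in scale -/

section Integrals

variable {n : ℕ}

lemma lintegral_comp_div_norm_sub {F : ℝ → ℝ≥0∞} (hF : Measurable F) {R : ℝ} (hR : 0 < R)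
    (c : EuclideanSpace ℝ (Fin n)) :
    ∫⁻ x, F (‖x - c‖ / R) = ENNReal.ofReal (R ^ n) * ∫⁻ x : EuclideanSpace ℝ (Fin n), F ‖x‖ := by
  rw [lintegral_sub_right_eq_self (fun x : EuclideanSpace ℝ (Fin n) => F (‖x‖ / R)) c]
  have h := Measure.map_addHaar_smul (volume : Measure (EuclideanSpace ℝ (Fin n)))
    (inv_ne_zero hR.ne')
  have h2 : ∫⁻ x : EuclideanSpace ℝ (Fin n), F (‖x‖ / R) =
      ∫⁻ x, F ‖x‖ ∂(Measure.map (fun x => R⁻¹ • x)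
      (volume : Measure (EuclideanSpace ℝ (Fin n)))) := by
    rw [lintegral_map (f := fun x : EuclideanSpace ℝ (Fin n) => F ‖x‖) (hF.comp measurable_norm)
      (measurable_const_smul _)]
    refine lintegral_congr fun x => ?_
    rw [norm_smul, norm_inv, Real.norm_of_nonneg hR.le, inv_mul_eq_div]
  rw [h2, h, lintegral_smul_measure]
  simp [abs_of_pos hR]

/-- The integral of `(1 + |x|)⁻ˢ`. -/
def japaneseIntegral (n : ℕ) (s : ℝ) : ℝ≥0∞ :=
  ∫⁻ x : EuclideanSpace ℝ (Fin n), ENNReal.ofReal ((1 + ‖x‖) ^ (-s))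

lemma japaneseIntegral_lt_top {s : ℝ} (hs : n < s) : japaneseIntegral n s < ∞ :=
  finite_integral_one_add_norm (by simpa using hs)

lemma lintegral_div_add_norm_rpow {R : ℝ} (hR : 0 < R) (s : ℝ)
    (c : EuclideanSpace ℝ (Fin n)) :
    ∫⁻ x, ENNReal.ofReal ((R / (R + ‖x - c‖)) ^ s) =
      ENNReal.ofReal (R ^ n) * japaneseIntegral n s := by
  rw [japaneseIntegral, ← lintegral_comp_div_norm_sub
    (F := fun u => ENNReal.ofReal ((1 + u) ^ (-s))) (by fun_prop) hR c]
  congr! 3 with x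
  have : R / (R + ‖x - c‖) = (1 + ‖x - c‖ / R)⁻¹ := by
    have : 0 < R + ‖x - c‖ := by positivity
    field_simp
  rw [this, Real.inv_rpow (by positivity), Real.rpow_neg (by positivity)]

/-- Off the doubled ball `R ≤ ‖x - c‖`, so `R / ‖x - c‖ ≤ 2R / (R + ‖x - c‖)`, whose powers
integrate by scaling to `japaneseIntegral`. -/
lemma lintegral_div_norm_rpow_compl_closedBall_le {R : ℝ} (hR : 0 < R) {s : ℝ} (hs : 0 ≤ s)
    (c : EuclideanSpace ℝ (Fin n)) :
    ∫⁻ x in (Metric.closedBall c (2 * R))ᶜ, ENNReal.ofReal ((R / ‖x - c‖) ^ s) ≤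
      ENNReal.ofReal (2 ^ s * R ^ n) * japaneseIntegral n s := by
  rw [ENNReal.ofReal_mul (by positivity), mul_assoc, ← lintegral_div_add_norm_rpow hR s c,
    ← lintegral_const_mul' _ _ ENNReal.ofReal_ne_top]
  refine (setLIntegral_mono' Metric.isClosed_closedBall.measurableSet.compl fun x hx => ?_).trans
    (setLIntegral_le_lintegral _ _)
  rw [Set.mem_compl_iff, Metric.mem_closedBall, dist_eq_norm, not_le] at hx
  rw [← ENNReal.ofReal_mul (by positivity), ← Real.mul_rpow (by norm_num) (by positivity)]
  refine ENNReal.ofReal_le_ofReal (Real.rpow_le_rpow (by positivity) ?_ hs)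
  rw [← mul_div_assoc, div_le_div_iff₀ (by linarith) (by positivity)]
  nlinarith

/-- The profile `min(t/R, R/t) ^ δ` of almost-orthogonality between scales. -/
def scaleDecay (δ R t : ℝ) : ℝ := min (t / R) (R / t) ^ δ

lemma scaleDecay_nonneg {δ R t : ℝ} (hR : 0 ≤ R) (ht : 0 ≤ t) : 0 ≤ scaleDecay δ R t :=
  Real.rpow_nonneg (le_min (by positivity) (by positivity)) _

lemma scaleDecay_comm (δ R t : ℝ) : scaleDecay δ R t = scaleDecay δ t R := by
  rw [scaleDecay, scaleDecay, min_comm]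

lemma scaleDecay_of_le {δ R t : ℝ} (hR : 0 < R) (ht : 0 < t) (h : t ≤ R) :
    scaleDecay δ R t = (t / R) ^ δ := by
  rw [scaleDecay, min_eq_left]
  rw [div_le_div_iff₀ hR ht]; nlinarith

lemma scaleDecay_of_ge {δ R t : ℝ} (hR : 0 < R) (ht : 0 < t) (h : R ≤ t) :
    scaleDecay δ R t = (R / t) ^ δ := by
  rw [scaleDecay_comm, scaleDecay_of_le ht hR h]

@[fun_prop]
lemma measurable_scaleDecay (δ : ℝ) :
    Measurable fun q : ℝ × ℝ => scaleDecay δ q.1 q.2 := by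
  unfold scaleDecay
  fun_prop

/-- Each of the ranges `t ≤ R` and `t > R` contributes exactly `1 / δ`. -/
lemma lintegral_scaleDecay_le {δ R : ℝ} (hδ : 0 < δ) (hR : 0 < R) :
    ∫⁻ t in Set.Ioi 0, ENNReal.ofReal (scaleDecay δ R t * t⁻¹) ≤ ENNReal.ofReal (2 / δ) := by
  have h1 : ∫⁻ t in Set.Ioc 0 R, ENNReal.ofReal (scaleDecay δ R t * t⁻¹) =
      ENNReal.ofReal (1 / δ) := by
    have hint : IntegrableOn (fun t : ℝ => (R ^ δ)⁻¹ * t ^ (δ - 1)) (Set.Ioc 0 R) :=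
      ((intervalIntegrable_iff_integrableOn_Ioc_of_le hR.le).1
        (intervalIntegral.intervalIntegrable_rpow' (by linarith))).const_mul _
    have h : ∀ t ∈ Set.Ioc 0 R, scaleDecay δ R t * t⁻¹ = (R ^ δ)⁻¹ * t ^ (δ - 1) := by
      rintro t ⟨ht, htR⟩
      rw [scaleDecay_of_le hR ht htR, Real.div_rpow ht.le hR.le, Real.rpow_sub_one ht.ne']
      ring
    rw [setLIntegral_congr_fun measurableSet_Ioc fun t ht => by rw [h t ht],
      ← ofReal_integral_eq_lintegral_ofReal hint
        ((ae_restrict_mem measurableSet_Ioc).mono fun t ht => by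
          have := ht.1
          positivity),
      integral_const_mul, ← intervalIntegral.integral_of_le hR.le,
      integral_rpow (Or.inl (by linarith))]
    have : R ^ δ ≠ 0 := (Real.rpow_pos_of_pos hR _).ne'
    congr 1
    rw [sub_add_cancel, Real.zero_rpow hδ.ne']
    field_simp
    ring
  have h2 : ∫⁻ t in Set.Ioi R, ENNReal.ofReal (scaleDecay δ R t * t⁻¹) =
      ENNReal.ofReal (1 / δ) := by
    have hint : IntegrableOn (fun t : ℝ => R ^ δ * t ^ (-δ - 1)) (Set.Ioi R) :=
      (integrableOn_Ioi_rpow_of_lt (by linarith) hR).const_mul _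
    have h : ∀ t ∈ Set.Ioi R, scaleDecay δ R t * t⁻¹ = R ^ δ * t ^ (-δ - 1) := by
      intro t ht
      have ht0 : 0 < t := hR.trans ht
      rw [scaleDecay_of_ge hR ht0 (le_of_lt ht), Real.div_rpow hR.le ht0.le,
        Real.rpow_sub_one ht0.ne', Real.rpow_neg ht0.le]
      ring
    rw [setLIntegral_congr_fun measurableSet_Ioi fun t ht => by rw [h t ht],
      ← ofReal_integral_eq_lintegral_ofReal hint
        ((ae_restrict_mem measurableSet_Ioi).mono fun t ht => by
          have : 0 < t := hR.trans ht
          positivity),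
      integral_const_mul, integral_Ioi_rpow_of_lt (by linarith) hR]
    have : R ^ δ ≠ 0 := (Real.rpow_pos_of_pos hR _).ne'
    congr 1
    rw [sub_add_cancel, Real.rpow_neg hR.le]
    field_simp
  rw [← Set.Ioc_union_Ioi_eq_Ioi hR.le]
  refine (lintegral_union_le _ _ _).trans ?_
  rw [h1, h2, ← ENNReal.ofReal_add (by positivity) (by positivity)]
  exact le_of_eq (by congr 1; ring)

end Integrals

/-! ### Schur's test and the `TT*` method -/

section AlmostOrthogonality

open scoped ComplexConjugate

variable {𝕜 : Type*} [RCLike 𝕜] {X Z : Type*} [MeasurableSpace X] [MeasurableSpace Z]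

lemma integrable_mul_conj_self_of_bound {μ : Measure X} [IsFiniteMeasure μ] {u : X → 𝕜}
    (hu : StronglyMeasurable u) {D : ℝ} (hD : ∀ x, ‖u x‖ ≤ D) :
    Integrable (fun x => u x * conj (u x)) μ := by
  refine Integrable.of_bound (hu.mul (RCLike.continuous_conj.comp_stronglyMeasurable
    hu)).aestronglyMeasurable (D * D) (Filter.Eventually.of_forall fun x => ?_)
  rw [norm_mul, RCLike.norm_conj]
  exact mul_le_mul (hD x) (hD x) (norm_nonneg _) ((norm_nonneg _).trans (hD x))

/-- This passes from `lintegral` to the Bochner integral of `u * conj u`, where duality and Fubini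
apply; it also shows that the left side is finite. -/
lemma lintegral_enorm_sq_eq_enorm_integral {μ : Measure X} [IsFiniteMeasure μ] {u : X → 𝕜}
    (hu : StronglyMeasurable u) {D : ℝ} (hD : ∀ x, ‖u x‖ ≤ D) :
    ∫⁻ x, ‖u x‖ₑ ^ 2 ∂μ = ‖∫ x, u x * conj (u x) ∂μ‖ₑ := by
  have hi := (integrable_mul_conj_self_of_bound (μ := μ) hu hD).norm
  have h1 : ∀ x, ‖u x * conj (u x)‖ = ‖u x‖ ^ 2 := fun x => by
    rw [norm_mul, RCLike.norm_conj, sq]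
  simp_rw [h1] at hi
  simp_rw [RCLike.mul_conj, ← RCLike.ofReal_pow]
  rw [integral_ofReal, ← ofReal_norm, RCLike.norm_ofReal, abs_of_nonneg (by positivity),
    ofReal_integral_eq_lintegral_ofReal hi (Filter.Eventually.of_forall fun x => by positivity)]
  refine lintegral_congr fun x => ?_
  rw [ENNReal.ofReal_pow (norm_nonneg _), ofReal_norm]

/-- Cauchy–Schwarz for `lintegral`, in squared form. -/
lemma lintegral_mul_sq_le {μ : Measure X} {f g : X → ℝ≥0∞} (hf : AEMeasurable f μ)
    (hg : AEMeasurable g μ) :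
    (∫⁻ x, f x * g x ∂μ) ^ 2 ≤ (∫⁻ x, f x ^ 2 ∂μ) * ∫⁻ x, g x ^ 2 ∂μ := by
  have h := ENNReal.lintegral_mul_le_Lp_mul_Lq μ Real.HolderConjugate.two_two hf hg
  simp only [Pi.mul_apply, ENNReal.rpow_ofNat] at h
  calc _ ≤ _ := pow_le_pow_left' h 2
    _ = _ := by
      rw [mul_pow, ← ENNReal.rpow_natCast, ← ENNReal.rpow_natCast, ← ENNReal.rpow_mul,
        ← ENNReal.rpow_mul]
      norm_num

lemma ennreal_mul_le_sq_add_sq (a b : ℝ≥0∞) : a * b ≤ a ^ 2 + b ^ 2 := by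
  rcases le_total a b with h | h
  · exact (mul_le_mul_left h b).trans (by rw [sq b]; exact le_add_self)
  · exact (mul_le_mul_right h a).trans (by rw [sq a]; exact le_self_add)

/-- Schur's test for a symmetric kernel, in bilinear form. -/
lemma lintegral_mul_kernel_le {μ : Measure X} [SFinite μ] {κ : X → X → ℝ≥0∞}
    (hκ : Measurable (Function.uncurry κ)) (hsymm : ∀ p q, κ p q = κ q p) {S : ℝ≥0∞}
    (hS : ∀ p, ∫⁻ q, κ p q ∂μ ≤ S) {u : X → ℝ≥0∞} (hu : Measurable u) :
    ∫⁻ q, u q.1 * u q.2 * κ q.1 q.2 ∂(μ.prod μ) ≤ 2 * S * ∫⁻ p, u p ^ 2 ∂μ := by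
  have hκ' : Measurable fun q : X × X => κ q.1 q.2 := hκ
  have h1 : ∫⁻ q, u q.1 ^ 2 * κ q.1 q.2 ∂(μ.prod μ) ≤ S * ∫⁻ p, u p ^ 2 ∂μ := by
    rw [lintegral_prod _ (by fun_prop), ← lintegral_const_mul _ (by fun_prop)]
    refine lintegral_mono fun p => ?_
    change ∫⁻ q, u p ^ 2 * κ p q ∂μ ≤ S * u p ^ 2
    rw [lintegral_const_mul (f := fun q => κ p q) _ (hκ'.comp measurable_prodMk_left), mul_comm]
    exact mul_le_mul_left (hS p) _
  have h2 : ∫⁻ q, u q.2 ^ 2 * κ q.1 q.2 ∂(μ.prod μ) ≤ S * ∫⁻ p, u p ^ 2 ∂μ := by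
    rw [← lintegral_prod_swap]
    simpa only [Prod.fst_swap, Prod.snd_swap, hsymm] using! h1
  -- The inequality `ab ≤ a² + b²`, without the factor 1/2, accounts for the 2 in the bound. By
  -- symmetry of `κ` both terms are controlled by the same marginal bound.
  calc _ ≤ ∫⁻ q, u q.1 ^ 2 * κ q.1 q.2 + u q.2 ^ 2 * κ q.1 q.2 ∂(μ.prod μ) := by
        refine lintegral_mono fun q => ?_
        rw [← add_mul]
        exact mul_le_mul_left (ennreal_mul_le_sq_add_sq _ _) _
    _ ≤ _ := by
        rw [lintegral_add_left (by fun_prop), mul_assoc, two_mul]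
        exact add_le_add h1 h2

/-- The `TT*` method with Schur's test: an integral operator whose kernel has a Gram matrix
dominated by a symmetric kernel with bounded marginals is bounded on `L²`. -/
theorem lintegral_enorm_integral_mul_sq_le {μ : Measure X} [IsFiniteMeasure μ] {ν : Measure Z}
    [IsFiniteMeasure ν] {k : X → Z → 𝕜} (hk : StronglyMeasurable (Function.uncurry k)) {M : ℝ}
    (hM : ∀ p z, ‖k p z‖ ≤ M) {κ : X → X → ℝ≥0∞} (hκ : Measurable (Function.uncurry κ))
    (hsymm : ∀ p q, κ p q = κ q p) (hG : ∀ p q, ‖∫ z, k p z * conj (k q z) ∂ν‖ₑ ≤ κ p q)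
    {S : ℝ≥0∞} (hS : ∀ p, ∫⁻ q, κ p q ∂μ ≤ S) {f : Z → 𝕜} (hf : StronglyMeasurable f)
    (hfi : Integrable f ν) :
    ∫⁻ p, ‖∫ z, k p z * f z ∂ν‖ₑ ^ 2 ∂μ ≤ 2 * S * ∫⁻ z, ‖f z‖ₑ ^ 2 ∂ν := by
  set U : X → 𝕜 := fun p => ∫ z, k p z * f z ∂ν with hU
  have hkf : StronglyMeasurable (Function.uncurry fun p z => k p z * f z) :=
    hk.mul (hf.comp_measurable measurable_snd)
  have hUm : StronglyMeasurable U := hkf.integral_prod_right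
  have hUD : ∀ p, ‖U p‖ ≤ M * ∫ z, ‖f z‖ ∂ν := fun p => by
    rw [← integral_const_mul]
    refine norm_integral_le_of_norm_le (hfi.norm.const_mul _)
      (Filter.Eventually.of_forall fun z => ?_)
    rw [norm_mul]
    exact mul_le_mul_of_nonneg_right (hM p z) (norm_nonneg _)
  set D := M * ∫ z, ‖f z‖ ∂ν
  have hcU : StronglyMeasurable fun p => conj (U p) :=
    RCLike.continuous_conj.comp_stronglyMeasurable hUm
  have hcUD : ∀ p, ‖conj (U p)‖ ≤ D := fun p => (RCLike.norm_conj _).trans_le (hUD p)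
  -- `H` is the transposed operator applied to `conj U`. Then `‖U‖₂² = ∫ H f`, while `‖H‖₂²` is a
  -- quadratic form in `U` with the Gram matrix as coefficients.
  set H : Z → 𝕜 := fun z => ∫ p, conj (U p) * k p z ∂μ with hH
  have hUk : StronglyMeasurable (Function.uncurry fun p z => conj (U p) * k p z) :=
    (hcU.comp_measurable measurable_fst).mul hk
  have hUkD : ∀ p z, ‖conj (U p) * k p z‖ ≤ D * M := fun p z => by
    rw [norm_mul]
    exact mul_le_mul (hcUD p) (hM p z) (norm_nonneg _) ((norm_nonneg _).trans (hcUD p))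
  have hHm : StronglyMeasurable H := hUk.integral_prod_left
  have hHD : ∀ z, ‖H z‖ ≤ D * M * μ.real Set.univ := fun z =>
    norm_integral_le_of_norm_le_const (Filter.Eventually.of_forall fun p => hUkD p z)
  have hI : ∫⁻ p, ‖U p‖ₑ ^ 2 ∂μ ≤ ∫⁻ z, ‖H z‖ₑ * ‖f z‖ₑ ∂ν := by
    have hint : Integrable (Function.uncurry fun p z => conj (U p) * (k p z * f z))
        (μ.prod ν) := by
      have h1 : Integrable (fun q : X × Z => f q.2) (μ.prod ν) := hfi.comp_snd μ
      have := h1.bdd_mul (c := D * M) hUk.aestronglyMeasurable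
        (Filter.Eventually.of_forall fun q => hUkD q.1 q.2)
      refine this.congr (Filter.Eventually.of_forall fun q => ?_)
      simp only [Function.uncurry, mul_assoc]
    have h : ∫ p, U p * conj (U p) ∂μ = ∫ z, H z * f z ∂ν := by
      calc _ = ∫ p, ∫ z, conj (U p) * (k p z * f z) ∂ν ∂μ := by
            refine integral_congr_ae (Filter.Eventually.of_forall fun p => ?_)
            simp only
            rw [integral_const_mul, mul_comm]
        _ = ∫ z, ∫ p, conj (U p) * (k p z * f z) ∂μ ∂ν := integral_integral_swap hint
        _ = _ := by
            refine integral_congr_ae (Filter.Eventually.of_forall fun z => ?_)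
            simp only [hH, ← mul_assoc]
            rw [integral_mul_const]
    rw [lintegral_enorm_sq_eq_enorm_integral hUm hUD, h]
    refine (enorm_integral_le_lintegral_enorm _).trans (le_of_eq ?_)
    simp_rw [enorm_mul]
  have hJ : ∫⁻ z, ‖H z‖ₑ ^ 2 ∂ν ≤ 2 * S * ∫⁻ p, ‖U p‖ₑ ^ 2 ∂μ := by
    let P : Z → X × X → 𝕜 := fun z q =>
      (conj (U q.1) * k q.1 z) * conj (conj (U q.2) * k q.2 z)
    have hPm : StronglyMeasurable (Function.uncurry P) := by
      have h1 : StronglyMeasurable fun w : Z × X × X => conj (U w.2.1) * k w.2.1 w.1 :=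
        hUk.comp_measurable (g := fun w : Z × X × X => (w.2.1, w.1)) (by fun_prop)
      have h2 : StronglyMeasurable fun w : Z × X × X => conj (U w.2.2) * k w.2.2 w.1 :=
        hUk.comp_measurable (g := fun w : Z × X × X => (w.2.2, w.1)) (by fun_prop)
      exact h1.mul (RCLike.continuous_conj.comp_stronglyMeasurable h2)
    have hint : Integrable (Function.uncurry P) (ν.prod (μ.prod μ)) := by
      refine Integrable.of_bound hPm.aestronglyMeasurable (D * M * (D * M))
        (Filter.Eventually.of_forall fun w => ?_)
      simp only [Function.uncurry, P]
      rw [norm_mul, RCLike.norm_conj]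
      exact mul_le_mul (hUkD _ _) (hUkD _ _) (norm_nonneg _)
        ((norm_nonneg _).trans (hUkD w.2.1 w.1))
    have h : ∫ z, H z * conj (H z) ∂ν = ∫ q, (conj (U q.1) * U q.2) *
        ∫ z, k q.1 z * conj (k q.2 z) ∂ν ∂(μ.prod μ) := by
      calc _ = ∫ z, ∫ q, P z q ∂(μ.prod μ) ∂ν := by
            refine integral_congr_ae (Filter.Eventually.of_forall fun z => ?_)
            simp only [P, hH]
            rw [← integral_conj, ← integral_prod_mul]
        _ = ∫ q, ∫ z, P z q ∂ν ∂(μ.prod μ) := integral_integral_swap hint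
        _ = _ := by
            refine integral_congr_ae (Filter.Eventually.of_forall fun q => ?_)
            simp only [P]
            rw [← integral_const_mul]
            refine integral_congr_ae (Filter.Eventually.of_forall fun z => ?_)
            simp only [map_mul, RCLike.conj_conj]
            ring
    rw [lintegral_enorm_sq_eq_enorm_integral hHm hHD, h]
    refine (enorm_integral_le_lintegral_enorm _).trans (le_trans ?_
      (lintegral_mul_kernel_le hκ hsymm hS hUm.enorm))
    refine lintegral_mono fun q => ?_
    rw [enorm_mul, enorm_mul, RCLike.enorm_conj]
    exact mul_le_mul_right (hG q.1 q.2) _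
  -- Cauchy–Schwarz gives `‖U‖₂⁴ ≤ 2S ‖f‖₂² ‖U‖₂²`. One factor `‖U‖₂²` may be cancelled once it is
  -- known to be finite and nonzero.
  have hIfin : ∫⁻ p, ‖U p‖ₑ ^ 2 ∂μ ≠ ∞ := by
    rw [lintegral_enorm_sq_eq_enorm_integral hUm hUD]
    exact enorm_ne_top
  rcases eq_or_ne (∫⁻ p, ‖U p‖ₑ ^ 2 ∂μ) 0 with h0 | h0
  · rw [h0]; exact bot_le
  have hsq : (∫⁻ p, ‖U p‖ₑ ^ 2 ∂μ) * (∫⁻ p, ‖U p‖ₑ ^ 2 ∂μ) ≤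
      (2 * S * ∫⁻ z, ‖f z‖ₑ ^ 2 ∂ν) * ∫⁻ p, ‖U p‖ₑ ^ 2 ∂μ := by
    rw [← sq]
    calc _ ≤ (∫⁻ z, ‖H z‖ₑ * ‖f z‖ₑ ∂ν) ^ 2 := pow_le_pow_left' hI 2
      _ ≤ _ := lintegral_mul_sq_le hHm.enorm.aemeasurable hf.enorm.aemeasurable
      _ ≤ _ := mul_le_mul_left hJ _
      _ = _ := by ring
  exact (ENNReal.mul_le_mul_iff_left h0 hIfin).1 hsq

end AlmostOrthogonality

/-! ### The `L²` bounds for the maximal convolution and for `g*` -/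

section SquareEstimate

open scoped ComplexConjugate

variable {𝕜 : Type*} [RCLike 𝕜] {n : ℕ} {α : ℝ} {φ ψ : EuclideanSpace ℝ (Fin n) → 𝕜}

/-- The volume of the unit ball. -/
def unitBallVolume (n : ℕ) : ℝ := volume.real (Metric.ball (0 : EuclideanSpace ℝ (Fin n)) 1)

lemma unitBallVolume_nonneg : 0 ≤ unitBallVolume n := measureReal_nonneg

lemma unitBallVolume_pos : 0 < unitBallVolume n :=
  ENNReal.toReal_pos (Metric.measure_ball_pos _ _ one_pos).ne' measure_ball_lt_top.ne

lemma volume_closedBall_eq (x : EuclideanSpace ℝ (Fin n)) {r : ℝ} (hr : 0 ≤ r) :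
    volume (Metric.closedBall x r) = ENNReal.ofReal (r ^ n * unitBallVolume n) := by
  rw [Measure.addHaar_closedBall _ _ hr, finrank_euclideanSpace_fin,
    ENNReal.ofReal_mul (by positivity), unitBallVolume, measureReal_def,
    ENNReal.ofReal_toReal measure_ball_lt_top.ne]

lemma conj_mem_kernelClass (hφ : φ ∈ kernelClass 𝕜 n α) :
    (fun x => conj (φ x)) ∈ kernelClass 𝕜 n α := by
  refine ⟨?_, ?_, fun x x' => ?_⟩
  · refine subset_trans (closure_mono fun x hx => ?_) hφ.1
    simpa using hx
  · rw [integral_conj, hφ.2.1, map_zero]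
  · rw [← map_sub, RCLike.norm_conj]
    exact hφ.2.2 x x'

lemma conj_dilation (t : ℝ) (x : EuclideanSpace ℝ (Fin n)) :
    conj (dilation φ t x) = dilation (fun x => conj (φ x)) t x := by
  simp [dilation, RCLike.real_smul_eq_coe_mul]

lemma integrable_dilation_sub (hn : 1 ≤ n) (hα : 0 < α) (hα' : α ≤ 1)
    (hφ : φ ∈ kernelClass 𝕜 n α) {t : ℝ} (ht : 0 < t) (y : EuclideanSpace ℝ (Fin n)) :
    Integrable fun z => dilation φ t (y - z) := by
  refine (integrableOn_iff_integrable_of_support_subset (s := Metric.closedBall y t)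
    fun z hz => ?_).1 ?_
  · by_contra h
    rw [Metric.mem_closedBall', dist_eq_norm, not_le] at h
    exact hz (dilation_eq_zero hφ ht h)
  · refine Measure.integrableOn_of_bounded (M := (|t| ^ n)⁻¹ * 3) measure_closedBall_lt_top.ne
      ((continuous_dilation (continuous_of_mem_kernelClass hα hφ) t).comp
        (continuous_const.sub continuous_id)).aestronglyMeasurable
      (Filter.Eventually.of_forall fun z => norm_dilation_le hn hα hα' hφ t _)

lemma integral_norm_dilation_sub_le (hn : 1 ≤ n) (hα : 0 < α) (hα' : α ≤ 1)
    (hφ : φ ∈ kernelClass 𝕜 n α) {t : ℝ} (ht : 0 < t) (y : EuclideanSpace ℝ (Fin n)) :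
    ∫ z, ‖dilation φ t (y - z)‖ ≤ 3 * unitBallVolume n := by
  rw [← setIntegral_eq_integral_of_forall_compl_eq_zero (s := Metric.closedBall y t) fun z hz => by
    rw [Metric.mem_closedBall', dist_eq_norm, not_le] at hz
    rw [dilation_eq_zero hφ ht hz, norm_zero]]
  have h : ∫ z in Metric.closedBall y t, ‖dilation φ t (y - z)‖ ≤
      ∫ _ in Metric.closedBall y t, (|t| ^ n)⁻¹ * 3 :=
    setIntegral_mono (integrable_dilation_sub hn hα hα' hφ ht y).norm.integrableOn
      (integrableOn_const measure_closedBall_lt_top.ne)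
      fun z => norm_dilation_le hn hα hα' hφ t _
  refine h.trans (le_of_eq ?_)
  rw [setIntegral_const, measureReal_def, volume_closedBall_eq y ht.le, ENNReal.toReal_ofReal
    (mul_nonneg (by positivity) unitBallVolume_nonneg), abs_of_pos ht, smul_eq_mul]
  field_simp

/-- The narrower kernel `φ_t(y - ·)` serves as a mean-zero function supported in a ball of radius
`t`, tested against the Hölder kernel of the larger scale `s`. -/
lemma norm_integral_dilation_mul_dilation_le_of_le (hn : 1 ≤ n) (hα : 0 < α) (hα' : α ≤ 1)
    (hφ : φ ∈ kernelClass 𝕜 n α) (hψ : ψ ∈ kernelClass 𝕜 n α) {t s : ℝ} (ht : 0 < t)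
    (hts : t ≤ s) (y x : EuclideanSpace ℝ (Fin n)) :
    ‖∫ z, dilation ψ s (x - z) * dilation φ t (y - z)‖ ≤
      3 * unitBallVolume n * (scaleDecay α t s * (max t s ^ n)⁻¹) := by
  have hs : 0 < s := ht.trans_le hts
  have h := norm_integral_dilation_mul_le_min hn hα hα' hψ
    (integrable_dilation_sub hn hα hα' hφ ht y) (c := y) (R := t) (fun z hz => by
      rw [← norm_neg, neg_sub] at hz
      exact dilation_eq_zero hφ ht hz) (integral_dilation_sub hφ t y) hs x
  refine h.trans ?_
  have h1 := integral_norm_dilation_sub_le hn hα hα' hφ ht y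
  rw [scaleDecay_of_ge ht hs hts, max_eq_right hts]
  calc _ ≤ (s ^ n)⁻¹ * (t / s) ^ α * (3 * unitBallVolume n) := by
        gcongr
        exact min_le_right _ _
    _ = _ := by ring

lemma norm_integral_dilation_mul_conj_dilation_le (hn : 1 ≤ n) (hα : 0 < α) (hα' : α ≤ 1)
    (hφ : φ ∈ kernelClass 𝕜 n α) (hψ : ψ ∈ kernelClass 𝕜 n α) {t s : ℝ} (ht : 0 < t)
    (hs : 0 < s) (y x : EuclideanSpace ℝ (Fin n)) :
    ‖∫ z, dilation φ t (y - z) * conj (dilation ψ s (x - z))‖ ≤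
      3 * unitBallVolume n * (scaleDecay α t s * (max t s ^ n)⁻¹) := by
  simp_rw [conj_dilation]
  rcases le_total t s with h | h
  · simp_rw [mul_comm (dilation φ t _)]
    exact norm_integral_dilation_mul_dilation_le_of_le hn hα hα' hφ (conj_mem_kernelClass hψ)
      ht h y x
  · rw [scaleDecay_comm, max_comm]
    exact norm_integral_dilation_mul_dilation_le_of_le hn hα hα' (conj_mem_kernelClass hψ) hφ
      hs h x y

lemma integral_dilation_mul_conj_dilation_eq_zero
    (hφ : φ ∈ kernelClass 𝕜 n α) (hψ : ψ ∈ kernelClass 𝕜 n α) {t s : ℝ} (ht : 0 < t)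
    (hs : 0 < s) {y x : EuclideanSpace ℝ (Fin n)} (h : t + s < ‖y - x‖) :
    ∫ z, dilation φ t (y - z) * conj (dilation ψ s (x - z)) = 0 := by
  refine integral_dilation_mul_eq_zero (c := x) (R := s) hφ (fun z hz => ?_) ht (by linarith)
  rw [← norm_neg, neg_sub] at hz
  rw [dilation_eq_zero hψ hs hz, map_zero]

/-- The measure `dy dt / t` on the upper half-space. -/
def halfSpaceMeasure (n : ℕ) : Measure (EuclideanSpace ℝ (Fin n) × ℝ) :=
  (volume.restrict {p | 0 < p.2}).withDensity fun p => ENNReal.ofReal p.2⁻¹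

instance : SFinite (halfSpaceMeasure n) := by
  unfold halfSpaceMeasure
  infer_instance

lemma measurableSet_halfSpace :
    MeasurableSet {p : EuclideanSpace ℝ (Fin n) × ℝ | 0 < p.2} :=
  measurableSet_lt measurable_const measurable_snd

lemma lintegral_halfSpaceMeasure {F : EuclideanSpace ℝ (Fin n) × ℝ → ℝ≥0∞} (hF : Measurable F) :
    ∫⁻ p, F p ∂halfSpaceMeasure n =
      ∫⁻ p in {p | 0 < p.2}, ENNReal.ofReal p.2⁻¹ * F p := by
  rw [halfSpaceMeasure, lintegral_withDensity_eq_lintegral_mul _ (by fun_prop) hF]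
  rfl

lemma ae_halfSpaceMeasure_pos : ∀ᵐ p ∂halfSpaceMeasure n, 0 < p.2 :=
  (withDensity_absolutelyContinuous _ _).ae_le (ae_restrict_mem measurableSet_halfSpace)

lemma lintegral_halfSpaceMeasure_eq_iterated {F : EuclideanSpace ℝ (Fin n) × ℝ → ℝ≥0∞}
    (hF : Measurable F) :
    ∫⁻ p, F p ∂halfSpaceMeasure n =
      ∫⁻ t in Set.Ioi 0, ENNReal.ofReal t⁻¹ * ∫⁻ y, F (y, t) := by
  rw [lintegral_halfSpaceMeasure hF]
  have : (volume.restrict {p : EuclideanSpace ℝ (Fin n) × ℝ | 0 < p.2}) =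
      (volume : Measure (EuclideanSpace ℝ (Fin n))).prod (volume.restrict (Set.Ioi 0)) := by
    rw [← Measure.restrict_univ (μ := (volume : Measure (EuclideanSpace ℝ (Fin n)))),
      Measure.prod_restrict, ← Measure.volume_eq_prod]
    congr 1
    ext p
    simp
  rw [this, lintegral_prod_symm _ (by fun_prop)]
  refine lintegral_congr fun t => ?_
  exact lintegral_const_mul' (ENNReal.ofReal t⁻¹) (fun y => F (y, t)) ENNReal.ofReal_ne_top

/-- The compact exhaustion of the upper half-space. -/
def halfSpaceBox (n N : ℕ) : Set (EuclideanSpace ℝ (Fin n) × ℝ) :=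
  Metric.closedBall 0 N ×ˢ Set.Icc ((N : ℝ) + 1)⁻¹ N

lemma measurableSet_halfSpaceBox (N : ℕ) : MeasurableSet (halfSpaceBox n N) :=
  Metric.isClosed_closedBall.measurableSet.prod measurableSet_Icc

lemma pos_of_mem_halfSpaceBox {N : ℕ} {p : EuclideanSpace ℝ (Fin n) × ℝ}
    (hp : p ∈ halfSpaceBox n N) : 0 < p.2 :=
  lt_of_lt_of_le (by positivity) hp.2.1

lemma halfSpaceMeasure_halfSpaceBox_lt_top (N : ℕ) :
    halfSpaceMeasure n (halfSpaceBox n N) < ∞ := by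
  rw [halfSpaceMeasure, withDensity_apply _ (measurableSet_halfSpaceBox N)]
  have h1 : ∫⁻ p in halfSpaceBox n N, ENNReal.ofReal p.2⁻¹ ∂(volume.restrict {p | 0 < p.2}) ≤
      ∫⁻ _ in halfSpaceBox n N, ENNReal.ofReal (N + 1) := by
    refine (lintegral_mono' (Measure.restrict_mono_measure Measure.restrict_le_self _)
      le_rfl).trans (setLIntegral_mono' (measurableSet_halfSpaceBox N) fun p hp => ?_)
    exact ENNReal.ofReal_le_ofReal (inv_le_of_inv_le₀ (by positivity) hp.2.1)
  refine h1.trans_lt ?_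
  rw [setLIntegral_const]
  refine ENNReal.mul_lt_top ENNReal.ofReal_lt_top ?_
  exact ((isCompact_closedBall _ _).prod isCompact_Icc).measure_lt_top

lemma monotone_halfSpaceBox : Monotone (halfSpaceBox n) := by
  intro M N h p hp
  have h' : (M : ℝ) ≤ N := by exact_mod_cast h
  refine ⟨Metric.closedBall_subset_closedBall h' hp.1, le_trans ?_ hp.2.1, hp.2.2.trans h'⟩
  gcongr

lemma iUnion_halfSpaceBox : ⋃ N, halfSpaceBox n N = {p | 0 < p.2} := by
  refine subset_antisymm (Set.iUnion_subset fun N p hp => pos_of_mem_halfSpaceBox hp) ?_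
  intro p hp
  obtain ⟨N, hN⟩ := exists_nat_ge (max ‖p.1‖ (max p.2 p.2⁻¹))
  rw [max_le_iff, max_le_iff] at hN
  refine Set.mem_iUnion.2 ⟨N, mem_closedBall_zero_iff.2 hN.1, ?_, hN.2.1⟩
  exact inv_le_of_inv_le₀ hp (by linarith [hN.2.2])

/-- The kernel dominating the Gram matrix of the dilated translated test kernels. -/
def gramBound (n : ℕ) (α : ℝ) (p q : EuclideanSpace ℝ (Fin n) × ℝ) : ℝ≥0∞ :=
  {w : (EuclideanSpace ℝ (Fin n) × ℝ) × (EuclideanSpace ℝ (Fin n) × ℝ) |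
    0 < w.1.2 ∧ 0 < w.2.2 ∧ ‖w.1.1 - w.2.1‖ ≤ w.1.2 + w.2.2}.indicator
    (fun w => ENNReal.ofReal
      (3 * unitBallVolume n * (scaleDecay α w.1.2 w.2.2 * (max w.1.2 w.2.2 ^ n)⁻¹))) (p, q)

lemma measurable_gramBound : Measurable (Function.uncurry (gramBound n α)) := by
  unfold gramBound
  refine Measurable.indicator ?_ ?_
  · have h := measurable_scaleDecay α
    have : Measurable fun w : (EuclideanSpace ℝ (Fin n) × ℝ) × (EuclideanSpace ℝ (Fin n) × ℝ) =>
        scaleDecay α w.1.2 w.2.2 := h.comp (by fun_prop : Measurable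
          fun w : (EuclideanSpace ℝ (Fin n) × ℝ) × (EuclideanSpace ℝ (Fin n) × ℝ) =>
            (w.1.2, w.2.2))
    fun_prop
  · refine (measurableSet_lt measurable_const (measurable_snd.comp measurable_fst)).inter
      ((measurableSet_lt measurable_const (measurable_snd.comp measurable_snd)).inter
      (measurableSet_le (f := fun w : (EuclideanSpace ℝ (Fin n) × ℝ) ×
        (EuclideanSpace ℝ (Fin n) × ℝ) => ‖w.1.1 - w.2.1‖) (g := fun w => w.1.2 + w.2.2)
        (by fun_prop) (by fun_prop)))

lemma gramBound_comm (p q : EuclideanSpace ℝ (Fin n) × ℝ) :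
    gramBound n α p q = gramBound n α q p := by
  unfold gramBound
  simp only [Set.indicator, Set.mem_ofPred_eq]
  rw [norm_sub_rev, add_comm, scaleDecay_comm, max_comm]
  congr 1
  exact propext (by tauto)

lemma enorm_integral_dilation_mul_conj_dilation_le (hn : 1 ≤ n) (hα : 0 < α) (hα' : α ≤ 1)
    (hφ : φ ∈ kernelClass 𝕜 n α) (hψ : ψ ∈ kernelClass 𝕜 n α)
    {p q : EuclideanSpace ℝ (Fin n) × ℝ} (hp : 0 < p.2) (hq : 0 < q.2) :
    ‖∫ z, dilation φ p.2 (p.1 - z) * conj (dilation ψ q.2 (q.1 - z))‖ₑ ≤ gramBound n α p q := by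
  unfold gramBound
  by_cases h : ‖p.1 - q.1‖ ≤ p.2 + q.2
  · have hmem : (p, q) ∈ {w : (EuclideanSpace ℝ (Fin n) × ℝ) × (EuclideanSpace ℝ (Fin n) × ℝ) |
        0 < w.1.2 ∧ 0 < w.2.2 ∧ ‖w.1.1 - w.2.1‖ ≤ w.1.2 + w.2.2} := ⟨hp, hq, h⟩
    rw [Set.indicator_of_mem hmem, ← ofReal_norm]
    exact ENNReal.ofReal_le_ofReal
      (norm_integral_dilation_mul_conj_dilation_le hn hα hα' hφ hψ hp hq _ _)
  · rw [integral_dilation_mul_conj_dilation_eq_zero hφ hψ hp hq (not_le.1 h)]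
    simp

/-- In space one integrates a constant over a ball of radius `t + s ≤ 2 max(t, s)`, whose volume
cancels `max(t, s) ^ (-n)`. What remains is the integral of `scaleDecay` against `ds / s`. -/
lemma lintegral_gramBound_le (hα : 0 < α) (p : EuclideanSpace ℝ (Fin n) × ℝ) :
    ∫⁻ q, gramBound n α p q ∂halfSpaceMeasure n ≤
      ENNReal.ofReal (3 * unitBallVolume n * (2 ^ n * unitBallVolume n)) *
        ENNReal.ofReal (2 / α) := by
  have hV := unitBallVolume_nonneg (n := n)
  rcases le_or_gt p.2 0 with hp | hp
  · have : ∀ q, gramBound n α p q = 0 := fun q => by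
      refine Set.indicator_of_notMem ?_ _
      rintro ⟨h, -⟩
      exact absurd h (not_lt.2 hp)
    simp [this]
  rw [lintegral_halfSpaceMeasure_eq_iterated (F := gramBound n α p)
    (measurable_gramBound.comp measurable_prodMk_left)]
  refine le_trans ?_ (mul_le_mul_right (lintegral_scaleDecay_le hα hp) _)
  rw [← lintegral_const_mul' _ _ ENNReal.ofReal_ne_top]
  refine setLIntegral_mono' measurableSet_Ioi fun s hs => ?_
  have hs : 0 < s := hs
  have h1 : ∀ y, gramBound n α p (y, s) = (Metric.closedBall p.1 (p.2 + s)).indicator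
      (fun _ => ENNReal.ofReal
        (3 * unitBallVolume n * (scaleDecay α p.2 s * (max p.2 s ^ n)⁻¹))) y := fun y => by
    simp only [gramBound, Set.indicator, Set.mem_ofPred_eq, Metric.mem_closedBall', dist_eq_norm,
      hp, hs, true_and]
  have hd := scaleDecay_nonneg (δ := α) hp.le hs.le
  have hm : 0 < max p.2 s := lt_max_of_lt_left hp
  simp_rw [h1]
  rw [lintegral_indicator Metric.isClosed_closedBall.measurableSet, setLIntegral_const,
    volume_closedBall_eq _ (by positivity), ← ENNReal.ofReal_mul (by positivity),
    ← ENNReal.ofReal_mul (by positivity), ← ENNReal.ofReal_mul (by positivity)]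
  refine ENNReal.ofReal_le_ofReal ?_
  have h2 : (p.2 + s) ^ n ≤ 2 ^ n * max p.2 s ^ n := by
    rw [← mul_pow]
    gcongr
    linarith [le_max_left p.2 s, le_max_right p.2 s]
  calc _ ≤ s⁻¹ * (3 * unitBallVolume n * (scaleDecay α p.2 s * (max p.2 s ^ n)⁻¹) *
        (2 ^ n * max p.2 s ^ n * unitBallVolume n)) := by gcongr
    _ = _ := by field_simp

/-- This linearizes the supremum: `m p` is the least index in a countable computing family that
attains half of it. Such an index exists because the supremum is finite, and it is measurable in `p`
because each competing condition is. -/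
lemma exists_measurable_near_maximal (𝕜 : Type*) [RCLike 𝕜] (hn : 1 ≤ n) (hα : 0 < α)
    (hα' : α ≤ 1) :
    ∃ φ : ℕ → EuclideanSpace ℝ (Fin n) → 𝕜, (∀ i, φ i ∈ kernelClass 𝕜 n α) ∧
      ∀ f : EuclideanSpace ℝ (Fin n) → 𝕜, StronglyMeasurable f → Integrable f →
        ∃ m : EuclideanSpace ℝ (Fin n) × ℝ → ℕ, Measurable m ∧ ∀ p,
          maximalConv α f p.1 p.2 ≤ 2 * ‖∫ z, dilation (φ (m p)) p.2 (p.1 - z) * f z‖ₑ := by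
  classical
  obtain ⟨φ, hφ, h⟩ := exists_seq_maximalConv_eq_iSup (n := n) 𝕜 hn hα hα'
  refine ⟨φ, hφ, fun f hf hfi => ?_⟩
  have hex : ∀ p : EuclideanSpace ℝ (Fin n) × ℝ, ∃ i,
      maximalConv α f p.1 p.2 ≤ 2 * ‖∫ z, dilation (φ i) p.2 (p.1 - z) * f z‖ₑ := by
    intro p
    by_contra! hlt
    have hfin := maximalConv_lt_top hn hα hα' hfi p.2 p.1
    have hle : maximalConv α f p.1 p.2 ≤ maximalConv α f p.1 p.2 / 2 := by
      conv_lhs => rw [h f hfi]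
      refine iSup_le fun i => ?_
      rw [ENNReal.le_div_iff_mul_le (by simp) (by simp), mul_comm]
      exact (hlt i).le
    have h0 : maximalConv α f p.1 p.2 ≠ 0 := (bot_le.trans_lt (hlt 0)).ne'
    exact absurd hle (not_le.2 (ENNReal.half_lt_self h0 hfin.ne))
  refine ⟨fun p => Nat.find (hex p), measurable_find hex fun i => ?_, fun p =>
    Nat.find_spec (hex p)⟩
  exact measurableSet_le (measurable_maximalConv hn hα hα' hf hfi)
    ((measurable_integral_dilation_mul (continuous_of_mem_kernelClass hα (hφ i))
      hf).enorm.const_mul _)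

/-- The constant in the `L²` estimate for `maximalConv`. -/
def squareConst (n : ℕ) (α : ℝ) : ℝ≥0∞ :=
  8 * (ENNReal.ofReal (3 * unitBallVolume n * (2 ^ n * unitBallVolume n)) *
    ENNReal.ofReal (2 / α))

/-- Truncation to a box makes the measures finite and the kernel bounded, as the `TT*` theorem
requires, with constants independent of `N`. The 8 in `squareConst` is 4, from squaring the factor 2
of near-maximality, times 2 from Schur's test. -/
lemma setLIntegral_halfSpaceBox_maximalConv_sq_le (hn : 1 ≤ n) (hα : 0 < α) (hα' : α ≤ 1)
    {f : EuclideanSpace ℝ (Fin n) → 𝕜} (hf : StronglyMeasurable f) (hfi : Integrable f) (N : ℕ) :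
    ∫⁻ p in halfSpaceBox n N, maximalConv α f p.1 p.2 ^ 2 ∂halfSpaceMeasure n ≤
      squareConst n α * ∫⁻ z, ‖f z‖ₑ ^ 2 := by
  classical
  obtain ⟨φ, hφ, h⟩ := exists_measurable_near_maximal (n := n) 𝕜 hn hα hα'
  obtain ⟨m, hm, hmax⟩ := h f hf hfi
  set μ := (halfSpaceMeasure n).restrict (halfSpaceBox n N) with hμ
  have : IsFiniteMeasure μ := ⟨by
    rw [Measure.restrict_apply_univ]; exact halfSpaceMeasure_halfSpaceBox_lt_top N⟩
  -- For `(y, t)` in the box, `|y| ≤ N` and `t ≤ N`, so `z ↦ φ_t(y - z)` lives in the ball of radius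
  -- `2N`.
  set B := Metric.closedBall (0 : EuclideanSpace ℝ (Fin n)) (2 * N)
  let k : EuclideanSpace ℝ (Fin n) × ℝ → EuclideanSpace ℝ (Fin n) → 𝕜 := fun p z =>
    (halfSpaceBox n N).indicator (fun p => dilation (φ (m p)) p.2 (p.1 - z)) p
  have hk : StronglyMeasurable (Function.uncurry k) := by
    have h1 : Measurable fun w : ℕ × (EuclideanSpace ℝ (Fin n) × ℝ) × EuclideanSpace ℝ (Fin n) =>
        dilation (φ w.1) w.2.1.2 (w.2.1.1 - w.2.2) :=
      measurable_from_prod_countable_right fun i =>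
        (measurable_dilation (continuous_of_mem_kernelClass hα (hφ i))).comp (by fun_prop :
          Measurable fun w : (EuclideanSpace ℝ (Fin n) × ℝ) × EuclideanSpace ℝ (Fin n) =>
            (w.1.2, w.1.1 - w.2))
    have h2 : Measurable fun w : (EuclideanSpace ℝ (Fin n) × ℝ) × EuclideanSpace ℝ (Fin n) =>
        dilation (φ (m w.1)) w.1.2 (w.1.1 - w.2) :=
      h1.comp (by fun_prop : Measurable
        fun w : (EuclideanSpace ℝ (Fin n) × ℝ) × EuclideanSpace ℝ (Fin n) => (m w.1, w.1, w.2))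
    have h3 : Measurable (Function.uncurry k) :=
      h2.indicator (s := Prod.fst ⁻¹' halfSpaceBox n N)
        (measurable_fst (measurableSet_halfSpaceBox N))
    exact h3.stronglyMeasurable
  have hM : ∀ p z, ‖k p z‖ ≤ ((N : ℝ) + 1) ^ n * 3 := fun p z => by
    by_cases hp : p ∈ halfSpaceBox n N
    · simp only [k, Set.indicator_of_mem hp]
      refine (norm_dilation_le hn hα hα' (hφ _) _ _).trans ?_
      rw [abs_of_pos (pos_of_mem_halfSpaceBox hp), ← inv_pow]
      gcongr
      · exact (inv_pos.2 (pos_of_mem_halfSpaceBox hp)).le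
      · exact inv_le_of_inv_le₀ (by positivity) hp.2.1
    · simp only [k, Set.indicator_of_notMem hp, norm_zero]
      positivity
  have hsupp : ∀ p z, z ∉ B → k p z = 0 := fun p z hz => by
    by_cases hp : p ∈ halfSpaceBox n N
    · simp only [k, Set.indicator_of_mem hp]
      refine dilation_eq_zero (hφ _) (pos_of_mem_halfSpaceBox hp) ?_
      rw [mem_closedBall_zero_iff, not_le] at hz
      have h1 := mem_closedBall_zero_iff.1 hp.1
      have h2 := hp.2.2
      have h3 := norm_sub_norm_le z p.1
      rw [norm_sub_rev] at h3
      linarith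
    · simp only [k, Set.indicator_of_notMem hp]
  have hG : ∀ p q, ‖∫ z in B, k p z * conj (k q z)‖ₑ ≤ gramBound n α p q := fun p q => by
    rw [setIntegral_eq_integral_of_forall_compl_eq_zero fun z hz => by rw [hsupp p z hz, zero_mul]]
    by_cases hp : p ∈ halfSpaceBox n N
    · by_cases hq : q ∈ halfSpaceBox n N
      · simp only [k, Set.indicator_of_mem hp, Set.indicator_of_mem hq]
        exact enorm_integral_dilation_mul_conj_dilation_le hn hα hα' (hφ _) (hφ _)
          (pos_of_mem_halfSpaceBox hp) (pos_of_mem_halfSpaceBox hq)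
      · simp [k, Set.indicator_of_notMem hq]
    · simp [k, Set.indicator_of_notMem hp]
  have : IsFiniteMeasure (volume.restrict B) := ⟨by
    rw [Measure.restrict_apply_univ]; exact measure_closedBall_lt_top⟩
  have key := lintegral_enorm_integral_mul_sq_le (μ := μ) (ν := volume.restrict B) hk hM
    measurable_gramBound gramBound_comm hG
    (fun p => (lintegral_mono' Measure.restrict_le_self le_rfl).trans
      (lintegral_gramBound_le hα p)) hf hfi.integrableOn
  calc _ ≤ ∫⁻ p, 4 * ‖∫ z in B, k p z * f z‖ₑ ^ 2 ∂μ := by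
        refine setLIntegral_mono' (measurableSet_halfSpaceBox N) fun p hp => ?_
        rw [setIntegral_eq_integral_of_forall_compl_eq_zero fun z hz => by
          rw [hsupp p z hz, zero_mul]]
        simp only [k, Set.indicator_of_mem hp]
        refine (pow_le_pow_left' (hmax p) 2).trans (le_of_eq ?_)
        rw [mul_pow]
        norm_num
    _ = 4 * ∫⁻ p, ‖∫ z in B, k p z * f z‖ₑ ^ 2 ∂μ := lintegral_const_mul' _ _ (by simp)
    _ ≤ 4 * (2 * _ * ∫⁻ z in B, ‖f z‖ₑ ^ 2) := mul_le_mul_right key _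
    _ ≤ 4 * (2 * _ * ∫⁻ z, ‖f z‖ₑ ^ 2) := by
        gcongr
        exact Measure.restrict_le_self
    _ = _ := by
        rw [squareConst, ← mul_assoc, ← mul_assoc]
        norm_num

/-- The intrinsic Littlewood–Paley estimate on `L²`. -/
theorem lintegral_maximalConv_sq_le (hn : 1 ≤ n) (hα : 0 < α) (hα' : α ≤ 1)
    {f : EuclideanSpace ℝ (Fin n) → 𝕜} (hf : StronglyMeasurable f) (hfi : Integrable f) :
    ∫⁻ p, maximalConv α f p.1 p.2 ^ 2 ∂halfSpaceMeasure n ≤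
      squareConst n α * ∫⁻ z, ‖f z‖ₑ ^ 2 := by
  have h1 : (halfSpaceMeasure n).restrict (⋃ N, halfSpaceBox n N) = halfSpaceMeasure n := by
    rw [iUnion_halfSpaceBox]
    exact Measure.restrict_eq_self_of_ae_mem ae_halfSpaceMeasure_pos
  rw [← h1, setLIntegral_iUnion_of_directed _ monotone_halfSpaceBox.directed_le]
  exact iSup_le fun N => setLIntegral_halfSpaceBox_maximalConv_sq_le hn hα hα' hf hfi N

/-- The weight of the `g*`-function relative to `dy dt / t`. -/
def gStarWeight {n : ℕ} (lam : ℝ) (x : EuclideanSpace ℝ (Fin n))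
    (p : EuclideanSpace ℝ (Fin n) × ℝ) : ℝ≥0∞ :=
  ENNReal.ofReal ((p.2 / (p.2 + ‖x - p.1‖)) ^ (lam * n) * (p.2 ^ n)⁻¹)

lemma measurable_gStarWeight (lam : ℝ) :
    Measurable (Function.uncurry (gStarWeight (n := n) lam)) := by
  unfold gStarWeight
  fun_prop

lemma gStar_eq (lam : ℝ) {f : EuclideanSpace ℝ (Fin n) → 𝕜}
    (hA : Measurable fun p : EuclideanSpace ℝ (Fin n) × ℝ => maximalConv α f p.1 p.2)
    (x : EuclideanSpace ℝ (Fin n)) :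
    gStar lam α f x = (∫⁻ p, gStarWeight lam x p * maximalConv α f p.1 p.2 ^ 2
      ∂halfSpaceMeasure n) ^ (1 / 2 : ℝ) := by
  have hW : Measurable (gStarWeight lam x) := (measurable_gStarWeight lam).comp
    measurable_prodMk_left
  rw [gStar, lintegral_halfSpaceMeasure (by fun_prop)]
  congr 1
  refine setLIntegral_congr_fun measurableSet_halfSpace fun p hp => ?_
  have hp : 0 < p.2 := hp
  simp only [gStarWeight]
  rw [ENNReal.ofReal_mul (by positivity), pow_succ p.2, one_div, mul_inv,
    ENNReal.ofReal_mul (by positivity)]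
  ring

lemma measurable_gStar (hn : 1 ≤ n) (hα : 0 < α) (hα' : α ≤ 1) (lam : ℝ)
    {f : EuclideanSpace ℝ (Fin n) → 𝕜} (hf : StronglyMeasurable f) (hfi : Integrable f) :
    Measurable (gStar lam α f) := by
  have hA := measurable_maximalConv hn hα hα' hf hfi
  rw [funext (gStar_eq lam hA)]
  refine Measurable.pow_const (Measurable.lintegral_prod_right' (ν := halfSpaceMeasure n)
    (f := fun w : EuclideanSpace ℝ (Fin n) × EuclideanSpace ℝ (Fin n) × ℝ =>
      gStarWeight lam w.1 w.2 * maximalConv α f w.2.1 w.2.2 ^ 2) ?_) _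
  exact (measurable_gStarWeight lam).mul ((hA.comp measurable_snd).pow_const 2)

/-- The intrinsic `g*`-function is bounded on `L²`. -/
theorem lintegral_gStar_sq_le (hn : 1 ≤ n) (hα : 0 < α) (hα' : α ≤ 1) (lam : ℝ)
    {f : EuclideanSpace ℝ (Fin n) → 𝕜} (hf : StronglyMeasurable f) (hfi : Integrable f) :
    ∫⁻ x, gStar lam α f x ^ 2 ≤
      japaneseIntegral n (lam * n) * (squareConst n α * ∫⁻ z, ‖f z‖ₑ ^ 2) := by
  have hA := measurable_maximalConv hn hα hα' hf hfi
  have hW := measurable_gStarWeight (n := n) lam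
  have h1 : ∀ x, gStar lam α f x ^ 2 = ∫⁻ p, gStarWeight lam x p *
      maximalConv α f p.1 p.2 ^ 2 ∂halfSpaceMeasure n := fun x => by
    rw [gStar_eq lam hA, ← ENNReal.rpow_natCast, ← ENNReal.rpow_mul]
    norm_num
  simp_rw [h1]
  -- By Tonelli the weight is integrated in `x` first. This gives `t ^ n * japaneseIntegral n (lam *
  -- n)`, and `t ^ n` cancels against the factor `(t ^ n)⁻¹` of the weight.
  rw [lintegral_lintegral_swap
    ((hW.mul ((hA.comp measurable_snd).pow_const 2)).aemeasurable)]
  refine le_trans (le_of_eq ?_)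
    (mul_le_mul_right (lintegral_maximalConv_sq_le hn hα hα' hf hfi) _)
  rw [← lintegral_const_mul _ (hA.pow_const 2)]
  refine lintegral_congr_ae (ae_halfSpaceMeasure_pos.mono fun p hp => ?_)
  simp only
  rw [lintegral_mul_const (f := fun x => gStarWeight lam x p) _
    (hW.comp measurable_prodMk_right)]
  congr 1
  have h2 : ∀ x, gStarWeight lam x p = ENNReal.ofReal ((p.2 / (p.2 + ‖x - p.1‖)) ^ (lam * n)) *
      ENNReal.ofReal (p.2 ^ n)⁻¹ := fun x => ENNReal.ofReal_mul (by positivity)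
  simp_rw [h2]
  rw [lintegral_mul_const' _ _ ENNReal.ofReal_ne_top, lintegral_div_add_norm_rpow hp, mul_comm,
    ← mul_assoc, ← ENNReal.ofReal_mul (by positivity), inv_mul_cancel₀ (by positivity)]
  simp

end SquareEstimate

/-! ### Calderón–Zygmund decomposition from Vitali's covering lemma -/

section CalderonZygmund

variable {𝕜 : Type*} [RCLike 𝕜] {n : ℕ}

/-- The radii of the balls around `x` on which the mean of `|f|` exceeds `σ`. -/
def largeMeanRadii (f : EuclideanSpace ℝ (Fin n) → 𝕜) (σ : ℝ) (x : EuclideanSpace ℝ (Fin n)) :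
    Set ℝ :=
  {r | 0 < r ∧ ENNReal.ofReal σ * volume (Metric.closedBall x r) <
    ∫⁻ z in Metric.closedBall x r, ‖f z‖ₑ}

/-- A large mean forces `σ |B(0,1)| r ^ n ≤ ‖f‖₁`; for `r > 1` the bound `r ≤ r ^ n` avoids taking a
root. -/
lemma exists_bound_largeMeanRadii (hn : 1 ≤ n) {f : EuclideanSpace ℝ (Fin n) → 𝕜}
    (hfi : Integrable f) {σ : ℝ} (hσ : 0 < σ) :
    ∃ ρ : ℝ, ∀ x, ∀ r ∈ largeMeanRadii f σ x, r ≤ ρ := by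
  refine ⟨max 1 ((∫ z, ‖f z‖) / (σ * unitBallVolume n)), fun x r hr => ?_⟩
  have hr0 := hr.1
  have hV := unitBallVolume_pos (n := n)
  rcases le_or_gt r 1 with h1 | h1
  · exact le_max_of_le_left h1
  refine le_max_of_le_right ((le_self_pow₀ h1.le (by omega : n ≠ 0)).trans ?_)
  have h := hr.2.le.trans (setLIntegral_le_lintegral _ _)
  rw [volume_closedBall_eq x hr0.le, ← ENNReal.ofReal_mul hσ.le,
    ← ofReal_integral_norm_eq_lintegral_enorm hfi,
    ENNReal.ofReal_le_ofReal_iff (by positivity)] at h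
  rw [le_div_iff₀ (by positivity)]
  linarith

/-- Otherwise `5 ^ k * r` would be admissible for every `k`, against the boundedness of the radii.
The factor 5 is the enlargement later used in the Vitali covering. -/
lemma exists_stopping_radius (hn : 1 ≤ n) {f : EuclideanSpace ℝ (Fin n) → 𝕜}
    (hfi : Integrable f) {σ : ℝ} (hσ : 0 < σ) {x : EuclideanSpace ℝ (Fin n)}
    (hx : (largeMeanRadii f σ x).Nonempty) :
    ∃ r ∈ largeMeanRadii f σ x, 5 * r ∉ largeMeanRadii f σ x := by
  by_contra! h
  obtain ⟨r, hr⟩ := hx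
  obtain ⟨ρ, hρ⟩ := exists_bound_largeMeanRadii hn hfi hσ
  have hk : ∀ k : ℕ, 5 ^ k * r ∈ largeMeanRadii f σ x := fun k => by
    induction k with
    | zero => simpa using hr
    | succ k ih =>
      have := h _ ih
      rwa [← mul_assoc, ← pow_succ'] at this
  obtain ⟨k, hk'⟩ := pow_unbounded_of_one_lt (ρ / r) (by norm_num : (1 : ℝ) < 5)
  rw [div_lt_iff₀ hr.1] at hk'
  exact absurd (hρ x _ (hk k)) (not_le.2 hk')

/-- By Lebesgue differentiation `‖f x‖` is almost everywhere the limit of means over shrinking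
balls, all at most `σ` here. -/
lemma ae_norm_le_of_largeMeanRadii_eq_empty {f : EuclideanSpace ℝ (Fin n) → 𝕜}
    (hfi : Integrable f) {σ : ℝ} (hσ : 0 < σ) :
    ∀ᵐ x, largeMeanRadii f σ x = ∅ → ‖f x‖ ≤ σ := by
  filter_upwards [IsUnifLocDoublingMeasure.ae_tendsto_average
    (volume : Measure (EuclideanSpace ℝ (Fin n))) hfi.norm.locallyIntegrable 1] with x hx h
  have ht := hx (l := nhdsWithin (0 : ℝ) (Set.Ioi 0)) (fun _ => x) id Filter.tendsto_id
    (by filter_upwards [self_mem_nhdsWithin] with r hr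
        exact Metric.mem_closedBall_self (by simpa using (le_of_lt hr)))
  refine le_of_tendsto ht ?_
  filter_upwards [self_mem_nhdsWithin] with r hr
  have hr : 0 < r := hr
  have hle : ∫⁻ z in Metric.closedBall x r, ‖f z‖ₑ ≤
      ENNReal.ofReal σ * volume (Metric.closedBall x r) := by
    by_contra! hlt
    exact Set.notMem_empty r (h ▸ ⟨hr, hlt⟩)
  have hV := unitBallVolume_pos (n := n)
  rw [volume_closedBall_eq x hr.le, ← ENNReal.ofReal_mul hσ.le,
    ← ofReal_integral_norm_eq_lintegral_enorm hfi.integrableOn,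
    ENNReal.ofReal_le_ofReal_iff (by positivity)] at hle
  rw [setAverage_eq, measureReal_def, id, volume_closedBall_eq x hr.le,
    ENNReal.toReal_ofReal (by positivity), smul_eq_mul, inv_mul_le_iff₀ (by positivity)]
  linarith

/-- A countable family of pairwise disjoint sets `B i` with enlargements `W i ⊇ B i` can be
refined to disjoint sets between `B i` and `W i` that cover the union of the enlargements. -/
lemma exists_disjoint_between {X ι : Type*} [MeasurableSpace X] [Countable ι] {B W : ι → Set X}
    (hB : ∀ i, MeasurableSet (B i)) (hW : ∀ i, MeasurableSet (W i)) (hBW : ∀ i, B i ⊆ W i)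
    (hd : Pairwise (Function.onFun Disjoint B)) :
    ∃ Q : ι → Set X, (∀ i, MeasurableSet (Q i)) ∧ (∀ i, B i ⊆ Q i) ∧ (∀ i, Q i ⊆ W i) ∧
      Pairwise (Function.onFun Disjoint Q) ∧ ⋃ i, Q i = ⋃ i, W i := by
  classical
  obtain ⟨e, he⟩ := exists_injective_nat ι
  -- A point of some `B j` is assigned to that `j`; any other point goes to the first `W j`, in the
  -- enumeration `e`, that contains it.
  let Q : ι → Set X := fun i => B i ∪ (W i \ ((⋃ j, B j) ∪ ⋃ j, ⋃ (_ : e j < e i), W j))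
  have hQW : ∀ i, Q i ⊆ W i := fun i => Set.union_subset (hBW i) Set.sdiff_subset
  refine ⟨Q, fun i => ?_, fun i => Set.subset_union_left, hQW, fun i j hij => ?_,
    subset_antisymm (Set.iUnion_mono hQW) ?_⟩
  · exact (hB i).union ((hW i).diff ((MeasurableSet.iUnion hB).union
      (MeasurableSet.iUnion fun j => MeasurableSet.iUnion fun _ => hW j)))
  · rw [Function.onFun, Set.disjoint_left]
    rintro x (hi | ⟨hi, hi'⟩) (hj | ⟨hj, hj'⟩)
    · exact Set.disjoint_left.1 (hd hij) hi hj
    · exact hj' (Or.inl (Set.mem_iUnion.2 ⟨i, hi⟩))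
    · exact hi' (Or.inl (Set.mem_iUnion.2 ⟨j, hj⟩))
    · rcases lt_or_gt_of_ne (he.ne hij) with h | h
      · exact hj' (Or.inr (Set.mem_iUnion₂.2 ⟨i, h, hi⟩))
      · exact hi' (Or.inr (Set.mem_iUnion₂.2 ⟨j, h, hj⟩))
  · intro x hx
    by_cases hxB : x ∈ ⋃ j, B j
    · obtain ⟨j, hj⟩ := Set.mem_iUnion.1 hxB
      exact Set.mem_iUnion.2 ⟨j, Or.inl hj⟩
    have hex : ∃ k, ∃ j, e j = k ∧ x ∈ W j := by
      obtain ⟨j, hj⟩ := Set.mem_iUnion.1 hx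
      exact ⟨e j, j, rfl, hj⟩
    obtain ⟨j, hj, hxj⟩ := Nat.find_spec hex
    refine Set.mem_iUnion.2 ⟨j, Or.inr ⟨hxj, ?_⟩⟩
    rintro (h | h)
    · exact hxB h
    · obtain ⟨i, hi, hxi⟩ := Set.mem_iUnion₂.1 h
      exact Nat.find_min hex (hj ▸ hi) ⟨i, rfl, hxi⟩

lemma enorm_setAverage_mul_le {X : Type*} [MeasurableSpace X] {μ : Measure X}
    (f : X → 𝕜) {Q : Set X} (hQ0 : μ Q ≠ 0) (hQ : μ Q ≠ ∞) :
    ‖⨍ x in Q, f x ∂μ‖ₑ * μ Q ≤ ∫⁻ x in Q, ‖f x‖ₑ ∂μ := by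
  have h : (0 : ℝ) < μ.real Q := ENNReal.toReal_pos hQ0 hQ
  rw [setAverage_eq, enorm_smul, ← ofReal_norm (μ.real Q)⁻¹, norm_inv, Real.norm_of_nonneg h.le,
    ENNReal.ofReal_inv_of_pos h, measureReal_def, ENNReal.ofReal_toReal hQ, mul_comm, ← mul_assoc,
    ENNReal.mul_inv_cancel hQ0 hQ, one_mul]
  exact enorm_integral_le_lintegral_enorm _

lemma lintegral_enorm_indicator_sub_average_le {X : Type*} [MeasurableSpace X] {μ : Measure X}
    (f : X → 𝕜) {Q : Set X} (hQm : MeasurableSet Q) (hQ0 : μ Q ≠ 0)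
    (hQ : μ Q ≠ ∞) :
    ∫⁻ z, ‖Q.indicator (fun x => f x - ⨍ x in Q, f x ∂μ) z‖ₑ ∂μ ≤
      2 * ∫⁻ z in Q, ‖f z‖ₑ ∂μ := by
  simp_rw [enorm_indicator_eq_indicator_enorm]
  rw [lintegral_indicator hQm]
  calc _ ≤ ∫⁻ z in Q, ‖f z‖ₑ + ‖⨍ x in Q, f x ∂μ‖ₑ ∂μ :=
        lintegral_mono fun z => enorm_sub_le
    _ = (∫⁻ z in Q, ‖f z‖ₑ ∂μ) + ‖⨍ x in Q, f x ∂μ‖ₑ * μ Q := by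
        rw [lintegral_add_right _ measurable_const, setLIntegral_const]
    _ ≤ _ := by
        rw [two_mul]
        gcongr
        exact enorm_setAverage_mul_le f hQ0 hQ

lemma integral_indicator_sub_average {X : Type*} [MeasurableSpace X] {μ : Measure X}
    {f : X → 𝕜} (hfi : Integrable f μ) {Q : Set X} (hQm : MeasurableSet Q) (hQ0 : μ Q ≠ 0)
    (hQ : μ Q ≠ ∞) :
    ∫ z, Q.indicator (fun x => f x - ⨍ x in Q, f x ∂μ) z ∂μ = 0 := by
  have h : μ.real Q ≠ 0 := (ENNReal.toReal_pos hQ0 hQ).ne'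
  rw [integral_indicator hQm, integral_sub hfi.integrableOn (integrableOn_const hQ),
    setIntegral_const, setAverage_eq, smul_smul, mul_inv_cancel₀ h, one_smul, sub_self]

/-- The Calderón–Zygmund decomposition at height `σ`, with bad parts supported in balls. -/
theorem exists_calderonZygmund (hn : 1 ≤ n) {f : EuclideanSpace ℝ (Fin n) → 𝕜}
    (hf : StronglyMeasurable f) (hfi : Integrable f) {σ : ℝ} (hσ : 0 < σ) :
    ∃ (ι : Type) (_ : Countable ι) (c : ι → EuclideanSpace ℝ (Fin n)) (R : ι → ℝ)
      (g : EuclideanSpace ℝ (Fin n) → 𝕜) (b : ι → EuclideanSpace ℝ (Fin n) → 𝕜),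
      (∀ i, 0 < R i) ∧ StronglyMeasurable g ∧ Integrable g ∧
      (∀ᵐ x, ‖g x‖ₑ ≤ ENNReal.ofReal (5 ^ n * σ)) ∧ ∫⁻ x, ‖g x‖ₑ ≤ 3 * ∫⁻ x, ‖f x‖ₑ ∧
      (∀ i, StronglyMeasurable (b i)) ∧ (∀ i, Integrable (b i)) ∧
      (∀ i z, R i < ‖z - c i‖ → b i z = 0) ∧ (∀ i, ∫ z, b i z = 0) ∧
      ∑' i, ∫⁻ z, ‖b i z‖ₑ ≤ 2 * ∫⁻ x, ‖f x‖ₑ ∧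
      (∀ x, HasSum (fun i => b i x) (f x - g x)) ∧
      ∑' i, volume (Metric.closedBall (c i) (R i)) ≤
        ENNReal.ofReal (5 ^ n / σ) * ∫⁻ x, ‖f x‖ₑ := by
  classical
  let Ω : Set (EuclideanSpace ℝ (Fin n)) := {x | (largeMeanRadii f σ x).Nonempty}
  have hrad : ∀ x, ∃ r, x ∈ Ω → r ∈ largeMeanRadii f σ x ∧ 5 * r ∉ largeMeanRadii f σ x := by
    intro x
    by_cases hx : x ∈ Ω
    · obtain ⟨r, h1, h2⟩ := exists_stopping_radius hn hfi hσ hx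
      exact ⟨r, fun _ => ⟨h1, h2⟩⟩
    · exact ⟨0, fun h => absurd h hx⟩
  choose r hr using hrad
  obtain ⟨ρ, hρ⟩ := exists_bound_largeMeanRadii hn hfi hσ
  -- The selected stopping balls are disjoint, and their 5-fold enlargements cover `Ω`. The sets `Q
  -- i` built below between the two families play the role of the usual dyadic cubes.
  obtain ⟨u, huΩ, hud, huc⟩ := Vitali.exists_disjoint_subfamily_covering_enlargement_closedBall
    Ω (fun x => x) r ρ (fun x hx => hρ x _ (hr x hx).1) 5 (by norm_num)
  have hrpos : ∀ i : u, 0 < r i := fun i => (hr i (huΩ i.2)).1.1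
  have hcount : Countable u := (hud.countable_of_nonempty_interior fun x hx =>
    ((Metric.nonempty_ball.2 (hrpos ⟨x, hx⟩)).mono
      Metric.ball_subset_interior_closedBall)).to_subtype
  let B : u → Set (EuclideanSpace ℝ (Fin n)) := fun i => Metric.closedBall i (r i)
  let W : u → Set (EuclideanSpace ℝ (Fin n)) := fun i => Metric.closedBall i (5 * r i)
  have hBm : ∀ i, MeasurableSet (B i) := fun i => Metric.isClosed_closedBall.measurableSet
  have hWm : ∀ i, MeasurableSet (W i) := fun i => Metric.isClosed_closedBall.measurableSet
  have hBd : Pairwise (Function.onFun Disjoint B) := fun i j hij =>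
    hud i.2 j.2 (Subtype.coe_injective.ne hij)
  obtain ⟨Q, hQm, hBQ, hQW, hQd, hQU⟩ := exists_disjoint_between hBm hWm
    (fun i => Metric.closedBall_subset_closedBall (by linarith [hrpos i])) hBd
  have hΩQ : Ω ⊆ ⋃ i, Q i := fun x hx => by
    obtain ⟨j, hj, hsub⟩ := huc x hx
    rw [hQU]
    exact Set.mem_iUnion.2 ⟨⟨j, hj⟩, hsub (Metric.mem_closedBall_self (hr x hx).1.1.le)⟩
  have hQ0 : ∀ i, volume (Q i) ≠ 0 := fun i =>
    ((Metric.measure_closedBall_pos volume _ (hrpos i)).trans_le (measure_mono (hBQ i))).ne'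
  have hQfin : ∀ i, volume (Q i) ≠ ∞ := fun i =>
    ((measure_mono (hQW i)).trans_lt measure_closedBall_lt_top).ne
  have hWB : ∀ i, volume (W i) = ENNReal.ofReal (5 ^ n) * volume (B i) := fun i => by
    have := hrpos i
    rw [volume_closedBall_eq _ (by positivity), volume_closedBall_eq _ (by positivity),
      ← ENNReal.ofReal_mul (by positivity), mul_pow, mul_assoc]
  -- The radius `5 * r i` is not admissible, so the mean of `|f|` over `W i` is at most `σ`. Passing
  -- to `Q i ⊇ B i` costs `|W i| / |B i| = 5 ^ n`.
  have hmean : ∀ i, ∫⁻ z in Q i, ‖f z‖ₑ ≤ ENNReal.ofReal (5 ^ n * σ) * volume (Q i) := fun i => by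
    have h : ∫⁻ z in W i, ‖f z‖ₑ ≤ ENNReal.ofReal σ * volume (W i) := by
      by_contra! hlt
      exact (hr i (huΩ i.2)).2 ⟨by linarith [hrpos i], hlt⟩
    calc _ ≤ ∫⁻ z in W i, ‖f z‖ₑ := lintegral_mono_set (hQW i)
      _ ≤ _ := h
      _ = ENNReal.ofReal (5 ^ n * σ) * volume (B i) := by
        rw [hWB, mul_comm (5 ^ n), ENNReal.ofReal_mul hσ.le, mul_assoc]
      _ ≤ _ := by
        gcongr
        exact hBQ i
  let a : u → 𝕜 := fun i => ⨍ x in Q i, f x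
  let b : u → EuclideanSpace ℝ (Fin n) → 𝕜 := fun i => (Q i).indicator fun x => f x - a i
  have ha : ∀ i, ‖a i‖ₑ ≤ ENNReal.ofReal (5 ^ n * σ) := fun i =>
    (ENNReal.mul_le_mul_iff_left (hQ0 i) (hQfin i)).1
      ((enorm_setAverage_mul_le f (hQ0 i) (hQfin i)).trans (hmean i))
  have hbm : ∀ i, StronglyMeasurable (b i) := fun i =>
    (hf.sub stronglyMeasurable_const).indicator (hQm i)
  have hbi : ∀ i, Integrable (b i) := fun i =>
    (integrable_indicator_iff (hQm i)).2 (hfi.integrableOn.sub (integrableOn_const (hQfin i)))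
  have hbsum : ∑' i, ∫⁻ z, ‖b i z‖ₑ ≤ 2 * ∫⁻ x, ‖f x‖ₑ := by
    calc _ ≤ ∑' i, 2 * ∫⁻ z in Q i, ‖f z‖ₑ := ENNReal.tsum_le_tsum fun i =>
          lintegral_enorm_indicator_sub_average_le f (hQm i) (hQ0 i)
            (hQfin i)
      _ = 2 * ∫⁻ z in ⋃ i, Q i, ‖f z‖ₑ := by
          rw [ENNReal.tsum_mul_left, lintegral_iUnion hQm hQd]
      _ ≤ _ := mul_le_mul_right (setLIntegral_le_lintegral _ _) _
  have hin : ∀ j x, x ∈ Q j → HasSum (fun i => b i x) (f x - a j) := fun j x hx => by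
    have h : b j x = f x - a j := Set.indicator_of_mem hx _
    rw [← h]
    refine hasSum_single j fun i hij => Set.indicator_of_notMem (fun hi => ?_) _
    exact Set.disjoint_left.1 (hQd hij) hi hx
  have hout : ∀ x, x ∉ ⋃ i, Q i → HasSum (fun i => b i x) 0 := fun x hx => by
    have : (fun i => b i x) = fun _ => 0 := funext fun i =>
      Set.indicator_of_notMem (fun hi => hx (Set.mem_iUnion.2 ⟨i, hi⟩)) _
    rw [this]
    exact hasSum_zero
  have hsummable : ∀ x, Summable fun i => b i x := fun x => by
    by_cases hx : x ∈ ⋃ i, Q i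
    · obtain ⟨j, hj⟩ := Set.mem_iUnion.1 hx
      exact (hin j x hj).summable
    · exact (hout x hx).summable
  let g : EuclideanSpace ℝ (Fin n) → 𝕜 := fun x => f x - ∑' i, b i x
  have hgm : StronglyMeasurable g :=
    hf.sub (Measurable.tsum fun i => (hbm i).measurable).stronglyMeasurable
  have hg1 : ∫⁻ x, ‖g x‖ₑ ≤ 3 * ∫⁻ x, ‖f x‖ₑ := by
    calc _ ≤ ∫⁻ x, ‖f x‖ₑ + ∑' i, ‖b i x‖ₑ := lintegral_mono fun x =>
          enorm_sub_le.trans (by gcongr; exact enorm_tsum_le_tsum_enorm)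
      _ = (∫⁻ x, ‖f x‖ₑ) + ∑' i, ∫⁻ x, ‖b i x‖ₑ := by
          rw [lintegral_add_left hf.enorm, lintegral_tsum fun i => (hbm i).enorm.aemeasurable]
      _ ≤ (∫⁻ x, ‖f x‖ₑ) + 2 * ∫⁻ x, ‖f x‖ₑ := by gcongr
      _ = _ := by ring
  refine ⟨u, hcount, fun i => i, fun i => 5 * r i, g, b, fun i => by linarith [hrpos i], hgm,
    ⟨hgm.aestronglyMeasurable, hg1.trans_lt (ENNReal.mul_lt_top (by simp) hfi.2)⟩, ?_, hg1, hbm,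
    hbi, ?_, ?_, hbsum, ?_, ?_⟩
  · filter_upwards [ae_norm_le_of_largeMeanRadii_eq_empty hfi hσ] with x hx
    by_cases hxQ : x ∈ ⋃ i, Q i
    · obtain ⟨j, hj⟩ := Set.mem_iUnion.1 hxQ
      simp only [g, (hin j x hj).tsum_eq, sub_sub_cancel]
      exact ha j
    · simp only [g, (hout x hxQ).tsum_eq, sub_zero]
      rw [← ofReal_norm]
      refine ENNReal.ofReal_le_ofReal ((hx ?_).trans
        (le_mul_of_one_le_left hσ.le (one_le_pow₀ (by norm_num))))
      exact Set.not_nonempty_iff_eq_empty.1 fun h => hxQ (hΩQ h)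
  · intro i z hz
    refine Set.indicator_of_notMem (fun h => ?_) _
    have := hQW i h
    rw [Metric.mem_closedBall, dist_eq_norm] at this
    linarith
  · exact fun i => integral_indicator_sub_average hfi (hQm i) (hQ0 i) (hQfin i)
  · intro x
    simpa only [g, sub_sub_cancel] using (hsummable x).hasSum
  -- Here admissibility of `r i` itself enters: `σ |B i| < ∫_{B i} |f|`, and the `B i` are disjoint.
  · calc _ = ∑' i, ENNReal.ofReal (5 ^ n) * volume (B i) := tsum_congr hWB
      _ ≤ ∑' i, ENNReal.ofReal (5 ^ n / σ) * ∫⁻ z in B i, ‖f z‖ₑ :=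
          ENNReal.tsum_le_tsum fun i => by
            rw [div_eq_mul_inv, ENNReal.ofReal_mul (by positivity), mul_assoc,
              ENNReal.ofReal_inv_of_pos hσ]
            gcongr
            rw [mul_comm _⁻¹, ← div_eq_mul_inv, ENNReal.le_div_iff_mul_le (by simp [hσ])
              (by simp), mul_comm]
            exact (hr i (huΩ i.2)).1.2.le
      _ = ENNReal.ofReal (5 ^ n / σ) * ∫⁻ z in ⋃ i, B i, ‖f z‖ₑ := by
          rw [ENNReal.tsum_mul_left, lintegral_iUnion hBm hBd]
      _ ≤ _ := mul_le_mul_right (setLIntegral_le_lintegral _ _) _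

end CalderonZygmund

/-! ### `g*` of a mean-zero function supported in a ball -/

section Atoms

variable {𝕜 : Type*} [RCLike 𝕜] {n : ℕ} {α : ℝ}

/-- The left side bounds one slice at height `t`: weight, square of the maximal convolution, volume
of the ball of radius `R + t`. For `t ≤ R` the factors `t ^ (-3n)` are absorbed by `w ^ (3n + α)`,
the surplus `α` yielding `(t/R) ^ α * (R/r) ^ α`. For `t ≥ R` the volume is comparable to `t ^ n`,
so `w ^ (2n + α)` suffices: of the decay `(R/t) ^ (2α)`, half combines with `(t/r) ^ α` into `(R/r)
^ α` and half is the scale decay. -/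
lemma atom_profile_le (hα : 0 < α) (hα' : α ≤ 1) {e w t r R V : ℝ} (he : 3 * n + α ≤ e)
    (hw0 : 0 ≤ w) (hw1 : w ≤ 1) (hw : w ≤ 2 * (t / r)) (ht : 0 < t) (hR : 0 < R) (hRr : R ≤ r)
    (hV : 0 ≤ V) :
    w ^ e * (t ^ n)⁻¹ * ((t ^ n)⁻¹ * min 3 ((R / t) ^ α)) ^ 2 * ((R + t) ^ n * V) ≤
      9 * 2 ^ (4 * n + 1) * V * ((R ^ n)⁻¹ * (R / r) ^ (n + α / 2)) ^ 2 * scaleDecay α R t := by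
  have hr : 0 < r := hR.trans_le hRr
  have hpow : ∀ m : ℕ, (m : ℝ) + α ≤ e → w ^ e ≤ 2 ^ (m + 1) * (t / r) ^ m * (t / r) ^ α := by
    intro m hm
    calc w ^ e ≤ w ^ ((m : ℝ) + α) :=
          Real.rpow_le_rpow_of_exponent_ge' hw0 hw1 (by positivity) hm
      _ ≤ (2 * (t / r)) ^ ((m : ℝ) + α) := Real.rpow_le_rpow hw0 hw (by positivity)
      _ = (2 * (t / r)) ^ m * (2 ^ α * (t / r) ^ α) := by
          rw [Real.rpow_add (by positivity), Real.rpow_natCast,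
            Real.mul_rpow (by norm_num) (by positivity)]
      _ ≤ (2 * (t / r)) ^ m * (2 ^ (1 : ℝ) * (t / r) ^ α) := by
          gcongr
          norm_num
      _ = _ := by
          rw [Real.rpow_one, mul_pow]
          ring
  have hq : ((R / r) ^ (n + α / 2)) ^ 2 = (R / r) ^ (2 * n) * (R / r) ^ α := by
    rw [← Real.rpow_natCast, ← Real.rpow_mul (by positivity), ← Real.rpow_natCast (R / r),
      ← Real.rpow_add (by positivity)]
    push_cast
    congr 1
    ring
  have hmin : 0 ≤ min 3 ((R / t) ^ α) := le_min (by norm_num) (by positivity)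
  rw [mul_pow _ ((R / r) ^ _) 2, hq]
  rcases le_total t R with h | h
  · rw [scaleDecay_of_le hR ht h]
    have hs : (t / r) ^ α = (t / R) ^ α * (R / r) ^ α := by
      rw [← Real.mul_rpow (by positivity) (by positivity)]
      congr 1
      field_simp
    have h1 := hpow (3 * n) (by push_cast; exact he)
    rw [hs] at h1
    calc _ ≤ 2 ^ (3 * n + 1) * (t / r) ^ (3 * n) * ((t / R) ^ α * (R / r) ^ α) * (t ^ n)⁻¹ *
          ((t ^ n)⁻¹ * 3) ^ 2 * ((2 * R) ^ n * V) := by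
          gcongr
          · exact min_le_left _ _
          · linarith
      _ = 9 * 2 ^ (4 * n + 1) * V * (R / r) ^ n * (r ^ (2 * n))⁻¹ * (R / r) ^ α *
          (t / R) ^ α := by
          have : t ^ n ≠ 0 := by positivity
          have : r ^ n ≠ 0 := by positivity
          simp only [div_pow, mul_pow, pow_add, pow_mul', pow_one]
          field_simp
          ring
      _ ≤ 9 * 2 ^ (4 * n + 1) * V * 1 * (r ^ (2 * n))⁻¹ * (R / r) ^ α * (t / R) ^ α := by
          gcongr
          exact pow_le_one₀ (by positivity) ((div_le_one hr).2 hRr)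
      _ = _ := by
          have : R ^ n ≠ 0 := by positivity
          have : r ^ n ≠ 0 := by positivity
          simp only [div_pow, pow_mul']
          field_simp
  · rw [scaleDecay_of_ge hR ht h]
    have hs : (R / r) ^ α = (t / r) ^ α * (R / t) ^ α := by
      rw [← Real.mul_rpow (by positivity) (by positivity)]
      congr 1
      field_simp
    have h1 := hpow (2 * n) (by
      push_cast
      have : (0 : ℝ) ≤ n := by positivity
      linarith)
    rw [hs]
    calc _ ≤ 2 ^ (2 * n + 1) * (t / r) ^ (2 * n) * (t / r) ^ α * (t ^ n)⁻¹ *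
          ((t ^ n)⁻¹ * (R / t) ^ α) ^ 2 * ((2 * t) ^ n * V) := by
          gcongr
          · exact min_le_right _ _
          · linarith
      _ = 2 ^ (3 * n + 1) * V * (r ^ (2 * n))⁻¹ * ((t / r) ^ α * (R / t) ^ α) * (R / t) ^ α := by
          have : t ^ n ≠ 0 := by positivity
          have : r ^ n ≠ 0 := by positivity
          simp only [div_pow, mul_pow, pow_add, pow_mul', pow_one]
          field_simp
      _ ≤ 9 * 2 ^ (4 * n + 1) * V * (r ^ (2 * n))⁻¹ * ((t / r) ^ α * (R / t) ^ α) *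
          (R / t) ^ α := by
          have h9 : (2 : ℝ) ^ (3 * n + 1) ≤ 9 * 2 ^ (4 * n + 1) := by
            have : (2 : ℝ) ^ (3 * n + 1) ≤ 2 ^ (4 * n + 1) :=
              pow_le_pow_right₀ (by norm_num) (by omega)
            have : (0 : ℝ) < 2 ^ (4 * n + 1) := by positivity
            linarith
          gcongr
      _ = _ := by
          have : R ^ n ≠ 0 := by positivity
          have : r ^ n ≠ 0 := by positivity
          simp only [div_pow, pow_mul']
          field_simp

/-- The constant in the pointwise bound for `gStar` of an atom. -/
def atomConst (n : ℕ) (α : ℝ) : ℝ :=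
  Real.sqrt (9 * 2 ^ (4 * n + 1) * unitBallVolume n * (2 / α))

/-- The slices at height `t` are summed by `lintegral_scaleDecay_le`. The square root turns the
decay `(R/r) ^ (2n + α)` into `(R/r) ^ (n + α/2)`, still above the integrability exponent `n`. -/
lemma gStar_le_of_support (hn : 1 ≤ n) (hα : 0 < α) (hα' : α ≤ 1) {lam : ℝ}
    (hlam : 3 * n + α ≤ lam * n) {h : EuclideanSpace ℝ (Fin n) → 𝕜} (hh : StronglyMeasurable h)
    (hhi : Integrable h) {c : EuclideanSpace ℝ (Fin n)} {R : ℝ} (hR : 0 < R)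
    (hsupp : ∀ z, R < ‖z - c‖ → h z = 0) (h0 : ∫ z, h z = 0)
    {x : EuclideanSpace ℝ (Fin n)} (hx : 2 * R < ‖x - c‖) :
    gStar lam α h x ≤ ENNReal.ofReal
      (atomConst n α * ((R ^ n)⁻¹ * (R / ‖x - c‖) ^ (n + α / 2)) * ∫ z, ‖h z‖) := by
  have hV := unitBallVolume_nonneg (n := n)
  have hA := measurable_maximalConv hn hα hα' hh hhi
  have hW : Measurable (gStarWeight lam x) := (measurable_gStarWeight lam).comp
    measurable_prodMk_left
  set r := ‖x - c‖
  set I := ∫ z, ‖h z‖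
  have hI : 0 ≤ I := by positivity
  set K' := 9 * 2 ^ (4 * n + 1) * unitBallVolume n with hK'
  set D := (R ^ n)⁻¹ * (R / r) ^ (n + α / 2)
  have hr : 0 < r := by linarith
  have hD : 0 ≤ D := by positivity
  have hslice : ∀ t : ℝ, 0 < t → ∫⁻ y, gStarWeight lam x (y, t) * maximalConv α h y t ^ 2 ≤
      ENNReal.ofReal (K' * D ^ 2 * I ^ 2) * ENNReal.ofReal (scaleDecay α R t) := by
    intro t ht
    set w := min 1 (2 * (t / r))
    have hw0 : 0 ≤ w := le_min zero_le_one (by positivity)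
    set m := (t ^ n)⁻¹ * min 3 ((R / t) ^ α)
    have hm : 0 ≤ m := mul_nonneg (by positivity) (le_min (by norm_num) (by positivity))
    calc _ ≤ ∫⁻ y, (Metric.closedBall c (R + t)).indicator (fun _ =>
          ENNReal.ofReal (w ^ (lam * n) * (t ^ n)⁻¹ * (m * I) ^ 2)) y := by
          refine lintegral_mono fun y => ?_
          have hAy := maximalConv_le_of_support hn hα hα' hhi hsupp h0 ht y
          by_cases hy : y ∈ Metric.closedBall c (R + t)
          · rw [Set.indicator_of_mem hy] at hAy ⊢
            rw [ENNReal.ofReal_mul (by positivity), ENNReal.ofReal_pow (by positivity)]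
            gcongr
            refine ENNReal.ofReal_le_ofReal ?_
            -- `r ≤ |x - y| + |y - c| ≤ |x - y| + R + t`, and `R < r/2`.
            have hden : r / 2 ≤ t + ‖x - y‖ := by
              have h1 := norm_add_le (x - y) (y - c)
              rw [sub_add_sub_cancel] at h1
              rw [Metric.mem_closedBall, dist_eq_norm] at hy
              change r ≤ _ at h1
              linarith
            have hd : 0 < t + ‖x - y‖ := by positivity
            have h3 : 0 ≤ lam * n := le_trans (by positivity) hlam
            simp only
            gcongr
            refine le_min ((div_le_one hd).2 (by linarith [norm_nonneg (x - y)])) ?_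
            rw [← mul_div_assoc, div_le_div_iff₀ hd hr]
            nlinarith
          · rw [Set.indicator_of_notMem hy] at hAy ⊢
            simp [le_antisymm hAy bot_le]
      _ = ENNReal.ofReal (w ^ (lam * n) * (t ^ n)⁻¹ * m ^ 2 *
          ((R + t) ^ n * unitBallVolume n) * I ^ 2) := by
          rw [lintegral_indicator Metric.isClosed_closedBall.measurableSet, setLIntegral_const,
            volume_closedBall_eq _ (by positivity), ← ENNReal.ofReal_mul (by positivity)]
          congr 1
          ring
      _ ≤ ENNReal.ofReal (K' * D ^ 2 * scaleDecay α R t * I ^ 2) := by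
          refine ENNReal.ofReal_le_ofReal (mul_le_mul_of_nonneg_right ?_ (by positivity))
          exact atom_profile_le hα hα' hlam hw0 (min_le_left _ _) (min_le_right _ _) ht hR
            (by linarith) hV
      _ = _ := by
          rw [← ENNReal.ofReal_mul (by positivity)]
          congr 1
          ring
  rw [gStar_eq lam hA, one_div, ENNReal.rpow_inv_le_iff (by norm_num), ENNReal.rpow_ofNat,
    lintegral_halfSpaceMeasure_eq_iterated
      (F := fun p => gStarWeight lam x p * maximalConv α h p.1 p.2 ^ 2) (hW.mul (hA.pow_const 2)),
    atomConst, ← ENNReal.ofReal_pow (mul_nonneg (mul_nonneg (Real.sqrt_nonneg _) hD) hI), mul_pow,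
    mul_pow, Real.sq_sqrt (by positivity)]
  calc _ ≤ ∫⁻ t in Set.Ioi 0, ENNReal.ofReal (K' * D ^ 2 * I ^ 2) *
        ENNReal.ofReal (scaleDecay α R t * t⁻¹) := by
        refine setLIntegral_mono' measurableSet_Ioi fun t ht => ?_
        have ht : 0 < t := ht
        rw [ENNReal.ofReal_mul (scaleDecay_nonneg hR.le ht.le), mul_comm, ← mul_assoc]
        exact mul_le_mul_left (hslice t ht) _
    _ ≤ ENNReal.ofReal (K' * D ^ 2 * I ^ 2) * ENNReal.ofReal (2 / α) := by
        rw [lintegral_const_mul' _ _ ENNReal.ofReal_ne_top]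
        exact mul_le_mul_right (lintegral_scaleDecay_le hα hR) _
    _ = _ := by
        rw [← ENNReal.ofReal_mul (by positivity)]
        congr 1
        ring

/-- Integration of the pointwise decay produces `R ^ n`, which cancels `(R ^ n)⁻¹`, so the constant
does not depend on the ball. -/
lemma setLIntegral_gStar_le_of_support (hn : 1 ≤ n) (hα : 0 < α) (hα' : α ≤ 1) {lam : ℝ}
    (hlam : 3 * n + α ≤ lam * n) {h : EuclideanSpace ℝ (Fin n) → 𝕜} (hh : StronglyMeasurable h)
    (hhi : Integrable h) {c : EuclideanSpace ℝ (Fin n)} {R : ℝ} (hR : 0 < R)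
    (hsupp : ∀ z, R < ‖z - c‖ → h z = 0) (h0 : ∫ z, h z = 0) :
    ∫⁻ x in (Metric.closedBall c (2 * R))ᶜ, gStar lam α h x ≤
      ENNReal.ofReal (atomConst n α * 2 ^ (n + α / 2)) * japaneseIntegral n (n + α / 2) *
        ∫⁻ z, ‖h z‖ₑ := by
  have hK : 0 ≤ atomConst n α := Real.sqrt_nonneg _
  calc _ ≤ ∫⁻ x in (Metric.closedBall c (2 * R))ᶜ,
        ENNReal.ofReal (atomConst n α * (R ^ n)⁻¹ * ∫ z, ‖h z‖) *
          ENNReal.ofReal ((R / ‖x - c‖) ^ (n + α / 2)) := by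
        refine setLIntegral_mono' Metric.isClosed_closedBall.measurableSet.compl fun x hx => ?_
        rw [Set.mem_compl_iff, Metric.mem_closedBall, dist_eq_norm, not_le] at hx
        refine (gStar_le_of_support hn hα hα' hlam hh hhi hR hsupp h0 hx).trans (le_of_eq ?_)
        rw [← ENNReal.ofReal_mul (by positivity)]
        congr 1
        ring
    _ ≤ ENNReal.ofReal (atomConst n α * (R ^ n)⁻¹ * ∫ z, ‖h z‖) *
          (ENNReal.ofReal (2 ^ (n + α / 2) * R ^ n) * japaneseIntegral n (n + α / 2)) := by
        rw [lintegral_const_mul' _ _ ENNReal.ofReal_ne_top]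
        gcongr
        exact lintegral_div_norm_rpow_compl_closedBall_le hR (by positivity) c
    _ = _ := by
        rw [← ofReal_integral_norm_eq_lintegral_enorm hhi, ← mul_assoc,
          ← ENNReal.ofReal_mul (by positivity), mul_right_comm (ENNReal.ofReal _),
          ← ENNReal.ofReal_mul (by positivity)]
        congr 2
        field_simp

end Atoms

/-! ### Sublinearity of `g*` and the weak type estimate -/

section WeakType

variable {𝕜 : Type*} [RCLike 𝕜] {n : ℕ} {α : ℝ}

/-- Minkowski's inequality in `L²` for countable sums of nonnegative functions. -/
lemma lintegral_tsum_sq_rpow_le {X ι : Type*} [MeasurableSpace X] {μ : Measure X}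
    [Countable ι] {F : ι → X → ℝ≥0∞} (hF : ∀ i, Measurable (F i)) :
    (∫⁻ x, (∑' i, F i x) ^ 2 ∂μ) ^ (1 / 2 : ℝ) ≤
      ∑' i, (∫⁻ x, F i x ^ 2 ∂μ) ^ (1 / 2 : ℝ) := by
  have hfin : ∀ s : Finset ι, (∫⁻ x, (∑ i ∈ s, F i x) ^ 2 ∂μ) ^ (1 / 2 : ℝ) ≤
      ∑ i ∈ s, (∫⁻ x, F i x ^ 2 ∂μ) ^ (1 / 2 : ℝ) := by
    classical
    intro s
    induction s using Finset.induction_on with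
    | empty => simp
    | insert a s ha ih =>
      have h := ENNReal.lintegral_Lp_add_le (p := 2) (hF a).aemeasurable (μ := μ)
        (s.measurable_fun_sum fun i _ => hF i).aemeasurable (by norm_num)
      simp only [Pi.add_apply, ENNReal.rpow_ofNat] at h
      simp_rw [Finset.sum_insert ha]
      exact h.trans (by gcongr)
  have hdir : Directed (· ≤ ·) fun (s : Finset ι) (x : X) => (∑ i ∈ s, F i x) ^ 2 := by
    classical
    intro s t
    exact ⟨s ∪ t,
      fun x => pow_le_pow_left' (Finset.sum_le_sum_of_subset Finset.subset_union_left) 2,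
      fun x => pow_le_pow_left' (Finset.sum_le_sum_of_subset Finset.subset_union_right) 2⟩
  have hsup : ∀ x, (∑' i, F i x) ^ 2 = ⨆ s : Finset ι, (∑ i ∈ s, F i x) ^ 2 := fun x => by
    rw [ENNReal.tsum_eq_iSup_sum, ENNReal.iSup_pow]
  simp_rw [hsup]
  rw [lintegral_iSup_directed (fun s => ((s.measurable_fun_sum fun i _ => hF i).pow_const
    2).aemeasurable) hdir, one_div, ENNReal.rpow_inv_le_iff (by norm_num)]
  refine iSup_le fun s => ?_
  rw [← ENNReal.rpow_inv_le_iff (by norm_num), ← one_div]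
  exact (hfin s).trans (ENNReal.sum_le_tsum s)

lemma maximalConv_add_le (hn : 1 ≤ n) (hα : 0 < α) (hα' : α ≤ 1)
    {f g : EuclideanSpace ℝ (Fin n) → 𝕜} (hf : Integrable f) (hg : Integrable g)
    (y : EuclideanSpace ℝ (Fin n)) (t : ℝ) :
    maximalConv α (fun x => f x + g x) y t ≤ maximalConv α f y t + maximalConv α g y t := by
  refine iSup₂_le fun φ hφ => ?_
  simp_rw [mul_add]
  rw [integral_add (integrable_dilation_sub_mul hn hα hα' hφ hf t y)
    (integrable_dilation_sub_mul hn hα hα' hφ hg t y)]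
  exact (enorm_add_le _ _).trans (add_le_add
    (le_iSup₂ (f := fun φ (_ : φ ∈ kernelClass 𝕜 n α) => ‖∫ z, dilation φ t (y - z) * f z‖ₑ) φ hφ)
    (le_iSup₂ (f := fun φ (_ : φ ∈ kernelClass 𝕜 n α) => ‖∫ z, dilation φ t (y - z) * g z‖ₑ) φ hφ))

/-- Dilated kernels are bounded at fixed `t`, so summability of the `L¹` norms allows the sum and
the integral to be exchanged. -/
lemma maximalConv_tsum_le (hn : 1 ≤ n) (hα : 0 < α) (hα' : α ≤ 1) {ι : Type*} [Countable ι]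
    {b : ι → EuclideanSpace ℝ (Fin n) → 𝕜} (hb : ∀ i, Integrable (b i))
    (hsum : ∑' i, ∫⁻ x, ‖b i x‖ₑ ≠ ∞)
    (y : EuclideanSpace ℝ (Fin n)) (t : ℝ) :
    maximalConv α (fun x => ∑' i, b i x) y t ≤ ∑' i, maximalConv α (b i) y t := by
  refine iSup₂_le fun φ hφ => ?_
  have hi := fun i => integrable_dilation_sub_mul hn hα hα' hφ (hb i) t y
  have hle : ∀ i, ∫⁻ z, ‖dilation φ t (y - z) * b i z‖ₑ ≤
      ENNReal.ofReal ((|t| ^ n)⁻¹ * 3) * ∫⁻ z, ‖b i z‖ₑ := fun i => by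
    rw [← lintegral_const_mul' _ _ ENNReal.ofReal_ne_top]
    refine lintegral_mono fun z => ?_
    rw [enorm_mul, ← ofReal_norm]
    gcongr
    exact norm_dilation_le hn hα hα' hφ t _
  have hfin : ∑' i, ∫⁻ z, ‖dilation φ t (y - z) * b i z‖ₑ ≠ ∞ := by
    refine ((ENNReal.tsum_le_tsum hle).trans_lt ?_).ne
    rw [ENNReal.tsum_mul_left]
    exact ENNReal.mul_lt_top ENNReal.ofReal_lt_top hsum.lt_top
  have h := integral_tsum (fun i => (hi i).aestronglyMeasurable) hfin
  simp_rw [tsum_mul_left] at h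
  rw [h]
  refine enorm_tsum_le_tsum_enorm.trans (ENNReal.tsum_le_tsum fun i => ?_)
  exact le_iSup₂ (f := fun φ (_ : φ ∈ kernelClass 𝕜 n α) =>
    ‖∫ z, dilation φ t (y - z) * b i z‖ₑ) φ hφ

/-- With the weight moved into the measure, `gStar` at `x` is an `L²` norm, to which Minkowski's
inequality applies. -/
lemma gStar_eq_withDensity (lam : ℝ) {f : EuclideanSpace ℝ (Fin n) → 𝕜}
    (hA : Measurable fun p : EuclideanSpace ℝ (Fin n) × ℝ => maximalConv α f p.1 p.2)
    (x : EuclideanSpace ℝ (Fin n)) :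
    gStar lam α f x = (∫⁻ p, maximalConv α f p.1 p.2 ^ 2
      ∂(halfSpaceMeasure n).withDensity (gStarWeight lam x)) ^ (1 / 2 : ℝ) := by
  have hW : Measurable (gStarWeight lam x) := (measurable_gStarWeight lam).comp
    measurable_prodMk_left
  rw [gStar_eq lam hA, lintegral_withDensity_eq_lintegral_mul _ hW (hA.pow_const 2)]
  rfl

lemma gStar_add_le (hn : 1 ≤ n) (hα : 0 < α) (hα' : α ≤ 1) (lam : ℝ)
    {f g : EuclideanSpace ℝ (Fin n) → 𝕜} (hf : StronglyMeasurable f) (hfi : Integrable f)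
    (hg : StronglyMeasurable g) (hgi : Integrable g) (x : EuclideanSpace ℝ (Fin n)) :
    gStar lam α (fun x => f x + g x) x ≤ gStar lam α f x + gStar lam α g x := by
  have hAf := measurable_maximalConv hn hα hα' hf hfi
  have hAg := measurable_maximalConv hn hα hα' hg hgi
  rw [gStar_eq_withDensity lam hAf, gStar_eq_withDensity lam hAg,
    gStar_eq_withDensity (f := fun x => f x + g x) lam
      (measurable_maximalConv hn hα hα' (hf.add hg) (hfi.add hgi))]
  have h := ENNReal.lintegral_Lp_add_le (p := 2) hAf.aemeasurable
    (μ := (halfSpaceMeasure n).withDensity (gStarWeight lam x)) hAg.aemeasurable (by norm_num)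
  simp only [Pi.add_apply, ENNReal.rpow_ofNat] at h
  refine le_trans ?_ h
  gcongr with p
  exact maximalConv_add_le hn hα hα' hfi hgi _ _

lemma gStar_tsum_le (hn : 1 ≤ n) (hα : 0 < α) (hα' : α ≤ 1) (lam : ℝ) {ι : Type*} [Countable ι]
    {b : ι → EuclideanSpace ℝ (Fin n) → 𝕜} (hbm : ∀ i, StronglyMeasurable (b i))
    (hb : ∀ i, Integrable (b i)) (hsum : ∑' i, ∫⁻ x, ‖b i x‖ₑ ≠ ∞)
    (hS : StronglyMeasurable fun x => ∑' i, b i x) (hSi : Integrable fun x => ∑' i, b i x)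
    (x : EuclideanSpace ℝ (Fin n)) :
    gStar lam α (fun x => ∑' i, b i x) x ≤ ∑' i, gStar lam α (b i) x := by
  have hA := fun i => measurable_maximalConv hn hα hα' (hbm i) (hb i)
  simp_rw [fun i => gStar_eq_withDensity lam (hA i)]
  rw [gStar_eq_withDensity lam (measurable_maximalConv hn hα hα' hS hSi)]
  refine le_trans ?_ (lintegral_tsum_sq_rpow_le hA)
  gcongr with p
  exact maximalConv_tsum_le hn hα hα' hb hsum _ _

/-- Chebyshev's inequality in `L²`, the `L²` bound for `gStar`, and `‖g‖₂² ≤ M ‖g‖₁`. -/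
lemma measure_le_gStar_of_bounded (hn : 1 ≤ n) (hα : 0 < α) (hα' : α ≤ 1) (lam : ℝ)
    {g : EuclideanSpace ℝ (Fin n) → 𝕜} (hg : StronglyMeasurable g) (hgi : Integrable g)
    {M s : ℝ} (hM : ∀ᵐ x, ‖g x‖ₑ ≤ ENNReal.ofReal M) (hs : 0 < s) :
    volume {x | ENNReal.ofReal s ≤ gStar lam α g x} ≤
      ENNReal.ofReal (M / s ^ 2) * (japaneseIntegral n (lam * n) * squareConst n α) *
        ∫⁻ x, ‖g x‖ₑ := by
  have hG := measurable_gStar hn hα hα' lam hg hgi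
  have h1 : ENNReal.ofReal (s ^ 2) * volume {x | ENNReal.ofReal s ≤ gStar lam α g x} ≤
      ENNReal.ofReal M * (japaneseIntegral n (lam * n) * squareConst n α) * ∫⁻ x, ‖g x‖ₑ := by
    calc _ ≤ ENNReal.ofReal (s ^ 2) *
          volume {x | ENNReal.ofReal (s ^ 2) ≤ gStar lam α g x ^ 2} := by
          refine mul_le_mul_right (measure_mono fun x hx => ?_) _
          change ENNReal.ofReal (s ^ 2) ≤ _
          rw [ENNReal.ofReal_pow hs.le]
          exact pow_le_pow_left' hx 2
      _ ≤ ∫⁻ x, gStar lam α g x ^ 2 := mul_meas_ge_le_lintegral (hG.pow_const 2) _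
      _ ≤ japaneseIntegral n (lam * n) * (squareConst n α * ∫⁻ z, ‖g z‖ₑ ^ 2) :=
          lintegral_gStar_sq_le hn hα hα' lam hg hgi
      _ ≤ japaneseIntegral n (lam * n) *
          (squareConst n α * (ENNReal.ofReal M * ∫⁻ z, ‖g z‖ₑ)) := by
          gcongr
          rw [← lintegral_const_mul' _ _ ENNReal.ofReal_ne_top]
          refine lintegral_mono_ae (hM.mono fun x hx => ?_)
          rw [sq]
          gcongr
      _ = _ := by ring
  rw [ENNReal.ofReal_div_of_pos (by positivity), ENNReal.div_eq_inv_mul, mul_assoc, mul_assoc,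
    ← ENNReal.div_eq_inv_mul, ENNReal.le_div_iff_mul_le (by simp [hs.ne']) (by simp), mul_comm,
    ← mul_assoc]
  exact h1

/-- The constant in the estimate of `gStar` away from the support of an atom. -/
def tailConst (n : ℕ) (α : ℝ) : ℝ≥0∞ :=
  ENNReal.ofReal (atomConst n α * 2 ^ (n + α / 2)) * japaneseIntegral n (n + α / 2)

/-- Chebyshev's inequality in `L¹` off the exceptional set; in each term the domain is then enlarged
to the complement of that term's own doubled ball. -/
lemma measure_le_tsum_gStar_compl (hn : 1 ≤ n) (hα : 0 < α) (hα' : α ≤ 1) {lam : ℝ}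
    (hlam : 3 * n + α ≤ lam * n) {ι : Type*} [Countable ι]
    {c : ι → EuclideanSpace ℝ (Fin n)} {R : ι → ℝ} (hR : ∀ i, 0 < R i)
    {b : ι → EuclideanSpace ℝ (Fin n) → 𝕜} (hbm : ∀ i, StronglyMeasurable (b i))
    (hb : ∀ i, Integrable (b i)) (hsupp : ∀ i z, R i < ‖z - c i‖ → b i z = 0)
    (h0 : ∀ i, ∫ z, b i z = 0) {s : ℝ} (hs : 0 < s) :
    volume ({x | ENNReal.ofReal s ≤ ∑' i, gStar lam α (b i) x} ∩
        (⋃ i, Metric.closedBall (c i) (2 * R i))ᶜ) ≤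
      ENNReal.ofReal s⁻¹ * (tailConst n α * ∑' i, ∫⁻ z, ‖b i z‖ₑ) := by
  have hG := fun i => measurable_gStar hn hα hα' lam (hbm i) (hb i)
  set O := ⋃ i, Metric.closedBall (c i) (2 * R i)
  have hm : MeasurableSet {x | ENNReal.ofReal s ≤ ∑' i, gStar lam α (b i) x} :=
    measurableSet_le measurable_const (Measurable.tsum hG)
  rw [← Measure.restrict_apply hm, ENNReal.ofReal_inv_of_pos hs, ← ENNReal.div_eq_inv_mul,
    ENNReal.le_div_iff_mul_le (by simp [hs]) (by simp), mul_comm]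
  refine (mul_meas_ge_le_lintegral (Measurable.tsum hG) _).trans ?_
  rw [lintegral_tsum fun i => (hG i).aemeasurable, ← ENNReal.tsum_mul_left]
  refine ENNReal.tsum_le_tsum fun i => ?_
  refine (lintegral_mono_set (Set.compl_subset_compl.2 (Set.subset_iUnion
    (fun i => Metric.closedBall (c i) (2 * R i)) i))).trans ?_
  exact setLIntegral_gStar_le_of_support hn hα hα' hlam (hbm i) (hb i) (hR i) (hsupp i) (h0 i)

/-- The constant in the weak type `(1, 1)` estimate for `gStar`. -/
def weakTypeConst (n : ℕ) (α lam : ℝ) : ℝ≥0∞ :=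
  ENNReal.ofReal (4 * 5 ^ n) * (japaneseIntegral n (lam * n) * squareConst n α) * 3 +
    ENNReal.ofReal (10 ^ n) + 4 * tailConst n α

lemma weakTypeConst_lt_top (hn : 1 ≤ n) (hα : 0 < α) {lam : ℝ} (hlam : 3 * n + α ≤ lam * n) :
    weakTypeConst n α lam < ∞ := by
  have hn' : (1 : ℝ) ≤ n := by exact_mod_cast hn
  have h1 : japaneseIntegral n (lam * n) < ∞ := japaneseIntegral_lt_top (by linarith)
  have h2 : japaneseIntegral n (n + α / 2) < ∞ := japaneseIntegral_lt_top (by linarith)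
  have h3 : squareConst n α < ∞ := ENNReal.mul_lt_top (by simp)
    (ENNReal.mul_lt_top ENNReal.ofReal_lt_top ENNReal.ofReal_lt_top)
  have h4 : tailConst n α < ∞ := ENNReal.mul_lt_top ENNReal.ofReal_lt_top h2
  exact ENNReal.add_lt_top.2 ⟨ENNReal.add_lt_top.2 ⟨ENNReal.mul_lt_top (ENNReal.mul_lt_top
    ENNReal.ofReal_lt_top (ENNReal.mul_lt_top h1 h3)) (by simp), ENNReal.ofReal_lt_top⟩,
    ENNReal.mul_lt_top (by simp) h4⟩

/-- Where `gStar f > σ`, either `gStar g` or the sum over the bad parts is at least `σ/2`. The three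
summands of `weakTypeConst` come from the good part (`5 ^ n * σ / (σ/2)² = 4 * 5 ^ n / σ` and `‖g‖₁
≤ 3 ‖f‖₁`), the doubled balls (`2 ^ n * 5 ^ n`), and the tails of the bad parts (2 from `σ/2`, 2
from their total `L¹` norm). -/
lemma measure_lt_gStar_le (hn : 1 ≤ n) (hα : 0 < α) (hα' : α ≤ 1) {lam : ℝ}
    (hlam : 3 * n + α ≤ lam * n) {f : EuclideanSpace ℝ (Fin n) → 𝕜} (hf : StronglyMeasurable f)
    (hfi : Integrable f) {σ : ℝ} (hσ : 0 < σ) :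
    volume {x | ENNReal.ofReal σ < gStar lam α f x} ≤
      ENNReal.ofReal σ⁻¹ * weakTypeConst n α lam * ∫⁻ x, ‖f x‖ₑ := by
  obtain ⟨ι, hι, c, R, g, b, hR, hgm, hgi, hgb, hg1, hbm, hbi, hsupp, hb0, hb1, hsum, hvol⟩ :=
    exists_calderonZygmund hn hf hfi hσ
  set N := ∫⁻ x, ‖f x‖ₑ
  set O := ⋃ i, Metric.closedBall (c i) (2 * R i)
  have hB : (fun x => ∑' i, b i x) = fun x => f x - g x := funext fun x => (hsum x).tsum_eq
  have hBm : StronglyMeasurable fun x => ∑' i, b i x := hB ▸ hf.sub hgm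
  have hBi : Integrable fun x => ∑' i, b i x := hB ▸ hfi.sub hgi
  have hfg : f = fun x => g x + ∑' i, b i x := by
    funext x
    rw [(hsum x).tsum_eq, add_sub_cancel]
  have hb1' : ∑' i, ∫⁻ z, ‖b i z‖ₑ ≠ ∞ :=
    (hb1.trans_lt (ENNReal.mul_lt_top (by simp) hfi.2)).ne
  have hsub : ∀ x, gStar lam α f x ≤ gStar lam α g x + ∑' i, gStar lam α (b i) x := fun x => by
    conv_lhs => rw [hfg]
    refine (gStar_add_le hn hα hα' lam hgm hgi hBm hBi x).trans ?_
    gcongr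
    exact gStar_tsum_le hn hα hα' lam hbm hbi hb1' hBm hBi x
  have hcover : {x | ENNReal.ofReal σ < gStar lam α f x} ⊆
      {x | ENNReal.ofReal (σ / 2) ≤ gStar lam α g x} ∪ O ∪
        ({x | ENNReal.ofReal (σ / 2) ≤ ∑' i, gStar lam α (b i) x} ∩ Oᶜ) := by
    intro x hx
    have hx : ENNReal.ofReal σ < gStar lam α f x := hx
    by_contra hnot
    simp only [Set.mem_union, Set.mem_inter_iff, Set.mem_compl_iff, Set.mem_ofPred_eq, not_or,
      not_and_or, not_not, not_le] at hnot
    obtain ⟨⟨h1, h2⟩, h3⟩ := hnot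
    have h4 := ENNReal.add_lt_add h1 (h3.resolve_right h2)
    rw [← ENNReal.ofReal_add (by positivity) (by positivity), add_halves] at h4
    exact absurd (hx.trans_le (hsub x)) (not_lt.2 h4.le)
  have h1 : volume {x | ENNReal.ofReal (σ / 2) ≤ gStar lam α g x} ≤ ENNReal.ofReal σ⁻¹ *
      (ENNReal.ofReal (4 * 5 ^ n) * (japaneseIntegral n (lam * n) * squareConst n α) * 3) * N := by
    refine (measure_le_gStar_of_bounded hn hα hα' lam hgm hgi hgb (half_pos hσ)).trans ?_
    have : 5 ^ n * σ / (σ / 2) ^ 2 = σ⁻¹ * (4 * 5 ^ n) := by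
      field_simp
      norm_num
    rw [this, ENNReal.ofReal_mul (by positivity)]
    calc _ ≤ ENNReal.ofReal σ⁻¹ * ENNReal.ofReal (4 * 5 ^ n) *
          (japaneseIntegral n (lam * n) * squareConst n α) * (3 * N) := by gcongr
      _ = _ := by ring
  have h2 : volume O ≤ ENNReal.ofReal σ⁻¹ * ENNReal.ofReal (10 ^ n) * N := by
    calc _ ≤ ∑' i, volume (Metric.closedBall (c i) (2 * R i)) := measure_iUnion_le _
      _ = ∑' i, ENNReal.ofReal (2 ^ n) * volume (Metric.closedBall (c i) (R i)) :=
          tsum_congr fun i => by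
            have := hR i
            rw [volume_closedBall_eq _ (by positivity), volume_closedBall_eq _ (by positivity),
              ← ENNReal.ofReal_mul (by positivity), mul_pow, mul_assoc]
      _ ≤ ENNReal.ofReal (2 ^ n) * (ENNReal.ofReal (5 ^ n / σ) * N) := by
          rw [ENNReal.tsum_mul_left]
          gcongr
      _ = _ := by
          rw [← mul_assoc, ← ENNReal.ofReal_mul (by positivity),
            ← ENNReal.ofReal_mul (by positivity)]
          congr 2
          rw [← mul_div_assoc, ← mul_pow]
          norm_num
          ring
  have h3 : volume ({x | ENNReal.ofReal (σ / 2) ≤ ∑' i, gStar lam α (b i) x} ∩ Oᶜ) ≤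
      ENNReal.ofReal σ⁻¹ * (4 * tailConst n α) * N := by
    refine (measure_le_tsum_gStar_compl hn hα hα' hlam hR hbm hbi hsupp hb0
      (half_pos hσ)).trans ?_
    have : (σ / 2)⁻¹ = σ⁻¹ * 2 := by field_simp
    rw [this, ENNReal.ofReal_mul (by positivity), ENNReal.ofReal_ofNat]
    calc _ ≤ ENNReal.ofReal σ⁻¹ * 2 * (tailConst n α * (2 * N)) := by gcongr
      _ = _ := by ring
  calc _ ≤ _ := measure_mono hcover
    _ ≤ _ := (measure_union_le _ _).trans (add_le_add_left (measure_union_le _ _) _)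
    _ ≤ _ := add_le_add (add_le_add h1 h2) h3
    _ = _ := by
        rw [weakTypeConst]
        ring

end WeakType

end IntrinsicSquare

end

theorem theorem5p1 {𝕜 : Type*} [RCLike 𝕜] (n : ℕ) (hn : 1 ≤ n) (α lam : ℝ)
    (hα : 0 < α) (hα' : α ≤ 1) (hlam : (3 * n + 2 * α) / n < lam) :
    ∃ C : ℝ, 0 < C ∧ ∀ f : EuclideanSpace ℝ (Fin n) → 𝕜, Integrable f → ∀ σ : ℝ, 0 < σ →
      volume {x | ENNReal.ofReal σ < IntrinsicSquare.gStar lam α f x} ≤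
        ENNReal.ofReal (C / σ) * ∫⁻ x, ‖f x‖ₑ := by
  have hn' : (0 : ℝ) < n := by exact_mod_cast hn
  rw [div_lt_iff₀ hn'] at hlam
  have hlam' : 3 * n + α ≤ lam * n := by linarith
  have hfin := IntrinsicSquare.weakTypeConst_lt_top hn hα hlam'
  refine ⟨(IntrinsicSquare.weakTypeConst n α lam).toReal + 1, by positivity,
    fun f hf σ hσ => ?_⟩
  -- `gStar` sees `f` only through integrals, so `f` may be replaced by a strongly measurable
  -- representative.
  have hae := hf.1.ae_eq_mk
  have hg : IntrinsicSquare.gStar lam α f = IntrinsicSquare.gStar lam α (hf.1.mk f) := by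
    funext x
    rw [IntrinsicSquare.gStar, IntrinsicSquare.gStar, IntrinsicSquare.maximalConv_congr_ae hae]
  have hN : ∫⁻ x, ‖f x‖ₑ = ∫⁻ x, ‖hf.1.mk f x‖ₑ :=
    lintegral_congr_ae (hae.mono fun x hx => by simp only [hx])
  rw [hg, hN]
  refine (IntrinsicSquare.measure_lt_gStar_le hn hα hα' hlam' hf.1.stronglyMeasurable_mk
    (hf.congr hae) hσ).trans ?_
  rw [div_eq_inv_mul, ENNReal.ofReal_mul (by positivity)]
  gcongr
  rw [← ENNReal.ofReal_toReal hfin.ne]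
  exact ENNReal.ofReal_le_ofReal (by simp)
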